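/- **Setting.** The language of urelement class theory is two-sorted: object variables $x,y,\dots$ (for sets and urelements) and class variables $X,Y,\dots$, with $=$, $\in$ (between objects, and between objects and classes) and a unary predicate $\mathscr A$ for urelements; sets are the objects that are not urelements. A structure is $\mathcal M=\langle M,\mathscr A^{\mathcal M},\in^{\mathcal M},\mathscr M\rangle$, where $\mathscr M\subseteq P(M)$ is the range of the class variables. KMU has the axioms: urelements have no members; Extensionality for sets; Class Extensionality; Foundation; Pairing; Union; Powerset; Infinity; Separation ($Y\cap x$ is a set for every class $Y$ and set $x$); Replacement (the image of a set under a class function is a set); Full Comprehension ($\{x:\varphi(x)\}$ is a class for every formula $\varphi$, with object and class parameters and quantifiers of both sorts); and AC (every set is well-orderable). KM is KMU + $\forall x\,\neg\mathscr A(x)$. Limitation of Size says that all proper classes (classes not co-extensional with a set) are equinumerous. RP$_2$ is the scheme $$\forall X_1\cdots\forall X_n\,\big[\varphi(X_1,\dots,X_n)\rightarrow\exists t\,(t\text{ is a transitive set}\wedge\varphi^t(X_1\cap t,\dots,X_n\cap t))\big],$$ for all formulas $\varphi$ of the language whose only free variables are $X_1,\dots,X_n$, where $\varphi^t$ restricts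 the object quantifiers to members of $t$ and the class quantifiers to subsets of $t$. *Bi-interpretability.* An interpretation $I$ with parameters is a finite list of formulas that defines, from admissible parameters $p$ (those satisfying a given formula) in a structure $\mathcal M$, a structure $I_p(\mathcal M)$ whose objects and classes are coded by finite tuples of objects and classes of $\mathcal M$; equality of objects is interpreted by a formula, and classes are identified when co-extensional. Theories $T_1,T_2$ are *bi-interpretable with parameters* if there are interpretations $I,J$ and formulas $\theta,\eta$ (with parameters), the same for all models, such that: every $\mathcal M\models T_1$ has admissible parameters for $I$, and for each admissible $p$, $I_p(\mathcal M)\models T_2$ and there is an admissible $q$ for $J$ in $I_p(\mathcal M)$ such that $\theta$ defines in $\mathcal M$, from some parameters, an isomorphism between $\mathcal M$ and $J_q(I_p(\mathcal M))$; and the same with $(T_1,I,\theta)$ and $(T_2,J,\eta)$ exchanged. *Two constructions.* If $\mathcal V=\langle V,\in,\mathscr V\rangle$ is a model of KM and $W\in\mathscr V$, then $V[\![W]\!]$ is the class given by the recursion $V[\![W]\!]=(\{0\}\times W)\cup\{\langle 1,x\rangle : x\text{ a set},\ x\subseteq V[\![W]\!]\}$, and $\mathcal V[\![W]\!]$ is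 the structure with objects $V[\![W]\!]$, urelements $\{0\}\times W$, membership $\bar x\mathrel{\bar\in}\bar y$ iff $\bar y=\langle 1,y\rangle$ for some $y$ with $\bar x\in y$, and classes $\{Y\in\mathscr V:Y\subseteq V[\![W]\!]\}$. The pure part of a model $\mathcal U$ has as objects the pure sets (those $x$ such that the transitive closure of $\{x\}$ contains no urelement) and as classes the classes of $\mathcal U$ all of whose members are pure sets. **Theorem.** 1. KM + RP$_2$ and KMU + RP$_2$ + Limitation of Size are bi-interpretable with parameters. 2. If $\mathcal V\models$ KM + RP$_2$ and $W$ is a class of $\mathcal V$, then exactly one class of $\mathcal V$ satisfies the recursion for $V[\![W]\!]$, and $\mathcal V[\![W]\!]\models$ KMU + RP$_2$ + Limitation of Size. 3. If $\mathcal U\models$ KMU + RP$_2$, then the pure part of $\mathcal U$ is a model of KM + RP$_2$. -/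

import Mathlib

universe u

/-!
Urelement class theory: the two-sorted language with object variables (for sets and urelements)
and class variables, its structures, the theories `KM` and `KMU`, the second-order reflection
principle, the structure `V⟦W⟧`, the pure part of a structure, and bi-interpretability with
parameters.
-/

/-- A structure `⟨M, 𝒜, ∈, 𝓜⟩` for the language of urelement class theory. The classes form an
arbitrary family `𝓜 ⊆ P(M)` of subsets of the first-order domain. -/
structure ClassModel where
  Obj : Type u
  mem : Obj → Obj → Prop
  ur : Obj → Prop
  classes : Set (Set Obj)

/-- Formulas of the language of urelement class theory, with free object variables in `α` and
free class variables in `β`. -/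
inductive Fml : Type → Type → Type 1
  /-- `x = y` -/
  | eqO {α β : Type} (x y : α) : Fml α β
  /-- `x ∈ y` for objects -/
  | memO {α β : Type} (x y : α) : Fml α β
  /-- `𝒜(x)` -/
  | ur {α β : Type} (x : α) : Fml α β
  /-- `X = Y` for classes -/
  | eqC {α β : Type} (X Y : β) : Fml α β
  /-- `x ∈ X` for an object `x` and a class `X` -/
  | memC {α β : Type} (x : α) (X : β) : Fml α β
  | neg {α β : Type} (φ : Fml α β) : Fml α β
  | and {α β : Type} (φ ψ : Fml α β) : Fml α β
  /-- `∃ x φ`; the bound variable is `none` -/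
  | exO {α β : Type} (φ : Fml (Option α) β) : Fml α β
  /-- `∃ X φ`; the bound variable is `none` -/
  | exC {α β : Type} (φ : Fml α (Option β)) : Fml α β

namespace ClassModel

/-- Satisfaction, with object variables ranging over `M.Obj` and class variables over
`M.classes`. -/
def Sat (M : ClassModel.{u}) :
    {α β : Type} → Fml α β → (α → M.Obj) → (β → M.classes) → Prop
  | _, _, .eqO x y, v, _ => v x = v y
  | _, _, .memO x y, v, _ => M.mem (v x) (v y)
  | _, _, .ur x, v, _ => M.ur (v x)
  | _, _, .eqC X Y, _, V => V X = V Y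
  | _, _, .memC x X, v, V => v x ∈ (V X : Set M.Obj)
  | _, _, .neg φ, v, V => ¬ M.Sat φ v V
  | _, _, .and φ ψ, v, V => M.Sat φ v V ∧ M.Sat ψ v V
  | _, _, .exO φ, v, V => ∃ a : M.Obj, M.Sat φ (fun i => i.elim a v) V
  | _, _, .exC φ, v, V => ∃ A : M.classes, M.Sat φ v (fun i => i.elim A V)

section Basic

variable (M : ClassModel.{u})

/-- `x` is a set, that is, not a urelement. -/
def IsSet (x : M.Obj) : Prop := ¬ M.ur x

/-- `z` is the empty set. -/
def IsEmptySet (z : M.Obj) : Prop := M.IsSet z ∧ ∀ v, ¬ M.mem v z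

/-- `z = {a, b}`. -/
def IsUPair (z a b : M.Obj) : Prop := M.IsSet z ∧ ∀ v, M.mem v z ↔ v = a ∨ v = b

/-- `z = ⟨a, b⟩ = {{a}, {a, b}}`. -/
def IsOPair (z a b : M.Obj) : Prop :=
  ∃ s d, M.IsUPair s a a ∧ M.IsUPair d a b ∧ M.IsUPair z s d

/-- `z = 1 = {∅}`. -/
def IsOne (z : M.Obj) : Prop := ∃ e, M.IsEmptySet e ∧ M.IsUPair z e e

/-- `⟨a, b⟩ ∈ F` for a class `F`. -/
def PairInClass (F : Set M.Obj) (a b : M.Obj) : Prop := ∃ z ∈ F, M.IsOPair z a b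

/-- `⟨a, b⟩ ∈ r` for a set `r`. -/
def PairInSet (r a b : M.Obj) : Prop := ∃ z, M.mem z r ∧ M.IsOPair z a b

/-- `x ⊆ y` for sets. -/
def Sub (x y : M.Obj) : Prop := ∀ z, M.mem z x → M.mem z y

/-- `t` is a transitive set: every member of `t` is included in `t`. -/
def IsTransSet (t : M.Obj) : Prop := M.IsSet t ∧ ∀ x, M.mem x t → M.Sub x t

/-- `X` is a proper class: it is not co-extensional with any set. -/
def IsProper (X : Set M.Obj) : Prop := ¬ ∃ s, M.IsSet s ∧ ∀ z, M.mem z s ↔ z ∈ X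

/-- `X` and `Y` are equinumerous: some class of ordered pairs is a bijection between them. -/
def Equinumerous (X Y : Set M.Obj) : Prop :=
  ∃ F ∈ M.classes,
    (∀ x ∈ X, ∃! y, y ∈ Y ∧ M.PairInClass F x y) ∧
    (∀ y ∈ Y, ∃! x, x ∈ X ∧ M.PairInClass F x y)

/-- The set `x` can be well-ordered: some set `r` of ordered pairs is a strict linear order on
`x` for which every non-empty subset of `x` has a least element. -/
def WellOrderable (x : M.Obj) : Prop :=
  ∃ r, M.IsSet r ∧
    (∀ a, M.mem a x → ¬ M.PairInSet r a a) ∧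
    (∀ a b c, M.mem a x → M.mem b x → M.mem c x →
      M.PairInSet r a b → M.PairInSet r b c → M.PairInSet r a c) ∧
    (∀ a b, M.mem a x → M.mem b x → M.PairInSet r a b ∨ a = b ∨ M.PairInSet r b a) ∧
    (∀ s, M.IsSet s → M.Sub s x → (∃ a, M.mem a s) →
      ∃ m, M.mem m s ∧ ∀ a, M.mem a s → a = m ∨ M.PairInSet r m a)

/-- Choice for sets: every set is well-orderable. -/
def AC : Prop := ∀ x, M.IsSet x → M.WellOrderable x

/-- Limitation of Size: all proper classes are equinumerous. -/
def LimitationOfSize : Prop :=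
  ∀ X ∈ M.classes, ∀ Y ∈ M.classes, M.IsProper X → M.IsProper Y → M.Equinumerous X Y

/-- Full Comprehension: for every formula, with object and class parameters and with quantifiers
of both sorts allowed, `{x : φ(x)}` is a class. -/
def FullComprehension : Prop :=
  ∀ (m n : ℕ) (φ : Fml (Option (Fin m)) (Fin n)) (v : Fin m → M.Obj) (V : Fin n → M.classes),
    {x : M.Obj | M.Sat φ (fun i => i.elim x v) V} ∈ M.classes

/-- The structure `⟨t, ∈, P(t)⟩` of a set `t`: its objects are the members of `t` and its classes
are the subsets of `t` (that is, their extensions). Satisfaction of `φ` in it is satisfaction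
in `M` of the relativization `φ^t`. -/
def below (t : M.Obj) : ClassModel.{u} where
  Obj := {x : M.Obj // M.mem x t}
  mem x y := M.mem x.1 y.1
  ur x := M.ur x.1
  classes := {Y | ∃ s, M.IsSet s ∧ M.Sub s t ∧ ∀ x, x ∈ Y ↔ M.mem x.1 s}

/-- The second-order reflection principle RP₂: for all classes `X₁, …, Xₙ`, if `φ(X₁, …, Xₙ)`
then there is a transitive set `t` with `φ^t(X₁ ∩ t, …, Xₙ ∩ t)`. -/
def RP2 : Prop :=
  ∀ (n : ℕ) (φ : Fml Empty (Fin n)) (X : Fin n → M.classes), M.Sat φ Empty.elim X →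
    ∃ t, M.IsTransSet t ∧ ∃ Y : Fin n → (M.below t).classes,
      (∀ i x, x ∈ (Y i : Set (M.below t).Obj) ↔ x.1 ∈ (X i : Set M.Obj)) ∧
      (M.below t).Sat φ Empty.elim Y

/-- Kelley–Morse class theory with urelements and choice for sets. Class Extensionality holds in
every `ClassModel`, and First-Order Comprehension is part of Full Comprehension. -/
structure IsKMU : Prop where
  ur_no_mem : ∀ x, M.ur x → ¬ ∃ y, M.mem y x
  ext : ∀ x y, M.IsSet x → M.IsSet y → (∀ z, M.mem z y ↔ M.mem z x) → x = y
  foundation : ∀ x, (∃ y, M.mem y x) → ∃ z, M.mem z x ∧ ¬ ∃ w, M.mem w z ∧ M.mem w x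
  pairing : ∀ x y, ∃ z, ∀ v, M.mem v z ↔ v = x ∨ v = y
  union : ∀ x, ∃ y, ∀ z, M.mem z y ↔ ∃ w, M.mem w x ∧ M.mem z w
  powerset : ∀ x, ∃ y, ∀ z, M.mem z y ↔ M.IsSet z ∧ M.Sub z x
  infinity : ∃ s, (∃ y, M.mem y s ∧ M.IsEmptySet y) ∧
    ∀ x, M.mem x s → ∃ y, M.mem y s ∧ M.IsSet y ∧ ∀ z, M.mem z y ↔ M.mem z x ∨ z = x
  separation : ∀ Y ∈ M.classes, ∀ x, M.IsSet x →
    ∃ y, M.IsSet y ∧ ∀ z, M.mem z y ↔ z ∈ Y ∧ M.mem z x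
  replacement : ∀ F ∈ M.classes, ∀ x, M.IsSet x →
    (∀ a, M.mem a x → ∃! b, M.PairInClass F a b) →
    ∃ y, M.IsSet y ∧ ∀ b, M.mem b y ↔ ∃ a, M.mem a x ∧ M.PairInClass F a b
  comprehension : M.FullComprehension
  choice : M.AC

/-- Kelley–Morse class theory with choice for sets: `KMU` without urelements. -/
structure IsKM : Prop where
  kmu : M.IsKMU
  no_ur : ∀ x, ¬ M.ur x

/-- `a` belongs to the transitive closure of `{x}`, the smallest transitive set with `x` as a
member. -/
def InTrcSingleton (a x : M.Obj) : Prop := ∀ t, M.IsTransSet t → M.mem x t → M.mem a t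

/-- `x` is a pure set: its kernel, consisting of the urelements in the transitive closure of
`{x}`, is empty. -/
def IsPure (x : M.Obj) : Prop := ∀ a, M.ur a → ¬ M.InTrcSingleton a x

/-- The pure part of a structure: the pure sets, with the classes all of whose members are pure
sets. -/
def purePart : ClassModel.{u} where
  Obj := {x : M.Obj // M.IsPure x}
  mem x y := M.mem x.1 y.1
  ur x := M.ur x.1
  classes := {Y | Subtype.val '' Y ∈ M.classes}

/-- `D` is the class `V⟦W⟧` defined by the recursion
`V⟦W⟧ = ({0} × W) ∪ {⟨1, x⟩ : x ⊆ V⟦W⟧}`. -/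
def IsUrDomain (W D : Set M.Obj) : Prop :=
  D ∈ M.classes ∧ ∀ y, y ∈ D ↔
    (∃ e a, M.IsEmptySet e ∧ a ∈ W ∧ M.IsOPair y e a) ∨
    (∃ o x, M.IsOne o ∧ M.IsSet x ∧ M.IsOPair y o x ∧ ∀ w, M.mem w x → w ∈ D)

/-- The structure on `V⟦W⟧ = D`: the urelements are the members of `{0} × W`, membership of `x`
in `y` means that `y = ⟨1, z⟩` for some `z` with `x ∈ z`, and the classes are the classes of `M`
that are included in `D`. -/
def urExtension (W D : Set M.Obj) : ClassModel.{u} where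
  Obj := {x : M.Obj // x ∈ D}
  mem x y := ∃ o z, M.IsOne o ∧ M.IsSet z ∧ M.IsOPair y.1 o z ∧ M.mem x.1 z
  ur x := ∃ e a, M.IsEmptySet e ∧ a ∈ W ∧ M.IsOPair x.1 e a
  classes := {Y | Subtype.val '' Y ∈ M.classes}

end Basic

/-- A tuple of objects indexed by `α` together with a tuple of classes indexed by `β`. -/
abbrev Tup (M : ClassModel.{u}) (α β : Type) : Type u := (α → M.Obj) × (β → M.classes)

/-- Satisfaction of a formula at the concatenation of two tuples. -/
def Sat₂ (M : ClassModel.{u}) {α β α' β' : Type} (φ : Fml (α ⊕ α') (β ⊕ β'))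
    (p : M.Tup α β) (s : M.Tup α' β') : Prop :=
  M.Sat φ (Sum.elim p.1 s.1) (Sum.elim p.2 s.2)

/-- Satisfaction of a formula at the concatenation of three tuples. -/
def Sat₃ (M : ClassModel.{u}) {α β α' β' α'' β'' : Type}
    (φ : Fml (α ⊕ (α' ⊕ α'')) (β ⊕ (β' ⊕ β'')))
    (p : M.Tup α β) (s : M.Tup α' β') (t : M.Tup α'' β'') : Prop :=
  M.Sat φ (Sum.elim p.1 (Sum.elim s.1 t.1)) (Sum.elim p.2 (Sum.elim s.2 t.2))

end ClassModel

/-- The formulas of an interpretation with parameters. There are `po` object and `pc` class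
parameters. An object of the interpreted structure is coded by a tuple of `oo` objects and `oc`
classes, and a class of it by a tuple of `co` objects and `cc` classes. Two codes of classes are
identified when they have the same interpreted members. -/
structure Interpretation where
  (po pc oo oc co cc : ℕ)
  /-- the admissible parameters -/
  adm : Fml (Fin po) (Fin pc)
  /-- the codes of objects -/
  domO : Fml (Fin po ⊕ Fin oo) (Fin pc ⊕ Fin oc)
  /-- the codes of classes -/
  domC : Fml (Fin po ⊕ Fin co) (Fin pc ⊕ Fin cc)
  /-- interpreted equality of objects -/
  eqO : Fml (Fin po ⊕ (Fin oo ⊕ Fin oo)) (Fin pc ⊕ (Fin oc ⊕ Fin oc))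
  /-- interpreted membership of objects in objects -/
  memO : Fml (Fin po ⊕ (Fin oo ⊕ Fin oo)) (Fin pc ⊕ (Fin oc ⊕ Fin oc))
  /-- the interpreted urelement predicate -/
  ur : Fml (Fin po ⊕ Fin oo) (Fin pc ⊕ Fin oc)
  /-- interpreted membership of objects in classes -/
  memC : Fml (Fin po ⊕ (Fin oo ⊕ Fin co)) (Fin pc ⊕ (Fin oc ⊕ Fin cc))

namespace Interpretation

open ClassModel

/-- The parameters of `I` in `M`. -/
abbrev Param (I : Interpretation) (M : ClassModel.{u}) : Type u := M.Tup (Fin I.po) (Fin I.pc)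

/-- The tuples of `M` in which `I` looks for codes of objects. -/
abbrev CodeO (I : Interpretation) (M : ClassModel.{u}) : Type u := M.Tup (Fin I.oo) (Fin I.oc)

/-- The tuples of `M` in which `I` looks for codes of classes. -/
abbrev CodeC (I : Interpretation) (M : ClassModel.{u}) : Type u := M.Tup (Fin I.co) (Fin I.cc)

/-- The parameter `p` is admissible. -/
def Admissible (I : Interpretation) (M : ClassModel.{u}) (p : I.Param M) : Prop :=
  M.Sat I.adm p.1 p.2

/-- `N` is (up to isomorphism) the structure that `I` defines in `M` from the parameter `p`, with
the codings `fO` and `fC`: `fO s a` says that `s` is a code of the object `a`, and `fC s A` that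
`s` is a code of the class `A`. -/
structure IsCoding (I : Interpretation) (M : ClassModel.{u}) (p : I.Param M) (N : ClassModel.{u})
    (fO : I.CodeO M → N.Obj → Prop) (fC : I.CodeC M → N.classes → Prop) : Prop where
  domO : ∀ s, M.Sat₂ I.domO p s ↔ ∃ a, fO s a
  domC : ∀ s, M.Sat₂ I.domC p s ↔ ∃ A, fC s A
  surjO : ∀ a, ∃ s, fO s a
  surjC : ∀ A, ∃ s, fC s A
  eqO : ∀ s t a b, fO s a → fO t b → (M.Sat₃ I.eqO p s t ↔ a = b)
  memO : ∀ s t a b, fO s a → fO t b → (M.Sat₃ I.memO p s t ↔ N.mem a b)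
  ur : ∀ s a, fO s a → (M.Sat₂ I.ur p s ↔ N.ur a)
  memC : ∀ s t a A, fO s a → fC t A → (M.Sat₃ I.memC p s t ↔ a ∈ (A : Set N.Obj))

/-- A tuple of codes, unravelled into one tuple. -/
def flat {M : ClassModel.{u}} (I : Interpretation) {α β : Type}
    (s : α → I.CodeO M) (t : β → I.CodeC M) :
    M.Tup ((α × Fin I.oo) ⊕ (β × Fin I.co)) ((α × Fin I.oc) ⊕ (β × Fin I.cc)) :=
  (Sum.elim (fun i => (s i.1).1 i.2) (fun j => (t j.1).1 j.2),
   Sum.elim (fun i => (s i.1).2 i.2) (fun j => (t j.1).2 j.2))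

/-- Formulas, with `po` object and `pc` class parameters, for the graph of an isomorphism between
a structure `M` and the structure that `J` defines inside the structure that `I` defines in `M`:
one formula for objects and one for classes. An object of the latter structure is given by a
tuple of `I`-codes in `M` for the entries of a `J`-code, and likewise for classes. -/
structure IsoFormulas (I J : Interpretation) where
  (po pc : ℕ)
  onO : Fml (Fin po ⊕ (((Fin J.oo × Fin I.oo) ⊕ (Fin J.oc × Fin I.co)) ⊕ Unit))
            (Fin pc ⊕ (((Fin J.oo × Fin I.oc) ⊕ (Fin J.oc × Fin I.cc)) ⊕ Empty))
  onC : Fml (Fin po ⊕ (((Fin J.co × Fin I.oo) ⊕ (Fin J.cc × Fin I.co)) ⊕ Empty))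
            (Fin pc ⊕ (((Fin J.co × Fin I.oc) ⊕ (Fin J.cc × Fin I.cc)) ⊕ Unit))

/-- Given codings of `N` in `M` by `I` and of `M` in `N` by `J`, the formulas `θ` with the
parameter `r` define in `M` the relation "`s` codes a `J`-code of `x`", that is, the isomorphism
between `M` and the copy of `M` defined inside the copy of `N` in `M`. -/
def DefinesIso {I J : Interpretation} (θ : IsoFormulas I J) (M N : ClassModel.{u})
    (r : M.Tup (Fin θ.po) (Fin θ.pc))
    (fO : I.CodeO M → N.Obj → Prop) (fC : I.CodeC M → N.classes → Prop)
    (gO : J.CodeO N → M.Obj → Prop) (gC : J.CodeC N → M.classes → Prop) : Prop :=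
  (∀ (s : Fin J.oo → I.CodeO M) (t : Fin J.oc → I.CodeC M) (x : M.Obj),
    M.Sat₃ θ.onO r (I.flat s t) (fun _ => x, Empty.elim) ↔
      ∃ n : J.CodeO N, (∀ i, fO (s i) (n.1 i)) ∧ (∀ j, fC (t j) (n.2 j)) ∧ gO n x) ∧
  (∀ (s : Fin J.co → I.CodeO M) (t : Fin J.cc → I.CodeC M) (X : M.classes),
    M.Sat₃ θ.onC r (I.flat s t) (Empty.elim, fun _ => X) ↔
      ∃ n : J.CodeC N, (∀ i, fO (s i) (n.1 i)) ∧ (∀ j, fC (t j) (n.2 j)) ∧ gC n X)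

/-- `I` interprets `T₂` in `T₁`, and `J` undoes it definably. In every model `M` of `T₁` there are
admissible parameters for `I`; each of them defines a model `N` of `T₂`; and in `N` there are
admissible parameters for `J` such that the structure they define is isomorphic to `M` by an
isomorphism that `θ` defines in `M` from parameters. -/
def Recovers (T₁ T₂ : ClassModel.{u} → Prop) (I J : Interpretation) (θ : IsoFormulas I J) :
    Prop :=
  ∀ M : ClassModel.{u}, T₁ M →
    (∃ p, I.Admissible M p) ∧
    ∀ p, I.Admissible M p →
      ∃ (N : ClassModel.{u}) (fO : I.CodeO M → N.Obj → Prop) (fC : I.CodeC M → N.classes → Prop),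
        I.IsCoding M p N fO fC ∧ T₂ N ∧
        ∃ (q : J.Param N) (gO : J.CodeO N → M.Obj → Prop) (gC : J.CodeC N → M.classes → Prop)
          (r : M.Tup (Fin θ.po) (Fin θ.pc)),
          J.Admissible N q ∧ J.IsCoding N q M gO gC ∧ DefinesIso θ M N r fO fC gO gC

end Interpretation

/-- Bi-interpretability with parameters of two theories in the language of urelement class
theory, each given by its models. The formulas are chosen first and serve for all models. -/
def BiInterpretable (T₁ T₂ : ClassModel.{u} → Prop) : Prop :=
  ∃ (I J : Interpretation) (θ : Interpretation.IsoFormulas I J)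
    (η : Interpretation.IsoFormulas J I),
    Interpretation.Recovers T₁ T₂ I J θ ∧ Interpretation.Recovers T₂ T₁ J I η

/-! RP₂ does the work of most axioms. Given Extensionality, Foundation, Separation, Full
Comprehension and memberless urelements, it yields every other axiom of KMU except Choice: one
reflects a suitable statement to a transitive set `t` and separates the wanted set from `t`, or
shows that it belongs to `t`. This fragment is `Core`, so a new structure needs only a short list of
checks.

Both V⟦W⟧ and the pure part are class structures inside the ambient model in which the members of
each object form a set and each set of objects is coded (`Realizes`). Satisfaction in such a
structure translates into the ambient one (`exists_relativization`). Comprehension transfers at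
once, and RP₂ transfers by reflecting to a `t` that contains the extension of each coded object in
it (`Realizes.rp2`). Choice and Limitation of Size are pulled back along the embedding.

Limitation of Size holds in KM + RP₂. If there were no class well-order of the universe, this would
reflect to some `t`, where every subset is a class, against the well-orderability of `t`. Sorting by
rank first makes the initial segments sets (`exists_setLike_wellOrder`), and matching two proper
classes along this order gives a bijection (`Core.limitationOfSize`).

For bi-interpretability, two realized structures are isomorphic by a class once their urelements are
in bijection by a class (`Realizes.exists_iso`): the isomorphism is the ∈-recursive matching. The
pure part of V⟦W⟧ and V have no urelements, so they are isomorphic for every W. Conversely, in a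
model of Limitation of Size the urelements together with the pure sets are equinumerous with the
pure sets. Hence the urelements are in bijection with a class W of pure sets, and the model is
isomorphic to the structure P⟦W⟧ built from W over its pure part P.

Recursions are obtained as fixed points of monotone operators (`exists_fix`), using comprehension
with class quantifiers; uniqueness comes from ∈-induction. -/

namespace Fml

/-! ### Renaming of variables. -/

/-- Renaming of the free variables of a formula. -/
def rename : {α β α' β' : Type} → Fml α β → (α → α') → (β → β') → Fml α' β'
  | _, _, _, _, .eqO x y, f, _ => .eqO (f x) (f y)
  | _, _, _, _, .memO x y, f, _ => .memO (f x) (f y)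
  | _, _, _, _, .ur x, f, _ => .ur (f x)
  | _, _, _, _, .eqC X Y, _, g => .eqC (g X) (g Y)
  | _, _, _, _, .memC x X, f, g => .memC (f x) (g X)
  | _, _, _, _, .neg φ, f, g => .neg (φ.rename f g)
  | _, _, _, _, .and φ ψ, f, g => .and (φ.rename f g) (ψ.rename f g)
  | _, _, _, _, .exO φ, f, g => .exO (φ.rename (Option.map f) g)
  | _, _, _, _, .exC φ, f, g => .exC (φ.rename f (Option.map g))

end Fml

namespace ClassModel

theorem sat_rename (M : ClassModel.{u}) {α β : Type} (φ : Fml α β) :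
    ∀ {α' β' : Type} (f : α → α') (g : β → β') (v : α' → M.Obj) (V : β' → M.classes),
    M.Sat (φ.rename f g) v V ↔ M.Sat φ (fun x => v (f x)) (fun X => V (g X)) := by
  induction φ with
  | eqO | memO | ur | eqC | memC => intros; rfl
  | neg φ ih => intros; exact not_congr (ih ..)
  | and φ ψ ih ih' => intros; exact and_congr (ih ..) (ih' ..)
  | exO φ ih =>
    intro α' β' f g v V
    refine exists_congr fun a => (ih ..).trans (iff_of_eq ?_)
    congr 1
    funext i; cases i <;> rfl
  | exC φ ih =>
    intro α' β' f g v V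
    refine exists_congr fun a => (ih ..).trans (iff_of_eq ?_)
    congr 1
    funext i; cases i <;> rfl

/-! ### A calculus of definability: parameter-free and uniform in all structures for reflection and
interpretations, with parameters in one structure for comprehension. -/

/-- `R` is defined by one formula in all the structures `𝓜 i`. If `k` holds, then parameters are
allowed. -/
class Dfn {ι : Type*} (k : Prop) (𝓜 : ι → ClassModel.{u}) {α β : Type}
    (R : ∀ i, (α → (𝓜 i).Obj) → (β → (𝓜 i).classes) → Prop) : Prop where
  out : ∃ (γ δ : Type) (_ : Finite γ) (_ : Finite δ) (_ : Nonempty γ ∨ Nonempty δ → k)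
    (p : ∀ i, γ → (𝓜 i).Obj) (P : ∀ i, δ → (𝓜 i).classes) (φ : Fml (α ⊕ γ) (β ⊕ δ)),
    ∀ i v V, (𝓜 i).Sat φ (Sum.elim v (p i)) (Sum.elim V (P i)) ↔ R i v V

/-- `f` is an object variable or, if `k` holds, an object parameter. -/
class TermO {ι : Type*} (k : Prop) (𝓜 : ι → ClassModel.{u}) {α : Type}
    (f : ∀ i, (α → (𝓜 i).Obj) → (𝓜 i).Obj) : Prop where
  out : (∃ x, f = fun _ v => v x) ∨ k ∧ ∃ c : ∀ i, (𝓜 i).Obj, f = fun i _ => c i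

/-- `f` is a class variable or, if `k` holds, a class parameter. -/
class TermC {ι : Type*} (k : Prop) (𝓜 : ι → ClassModel.{u}) {β : Type}
    (f : ∀ i, (β → (𝓜 i).classes) → (𝓜 i).classes) : Prop where
  out : (∃ x, f = fun _ V => V x) ∨ k ∧ ∃ c : ∀ i, (𝓜 i).classes, f = fun i _ => c i

section Dfn

variable {ι : Type*} {k : Prop} {𝓜 : ι → ClassModel.{u}} {α β : Type}

instance TermO.var (x : α) : TermO k 𝓜 (fun _ (v : α → _) => v x) := ⟨.inl ⟨x, rfl⟩⟩

instance TermO.const (c : ∀ i, (𝓜 i).Obj) : TermO True 𝓜 (fun i (_ : α → _) => c i) :=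
  ⟨.inr ⟨trivial, c, rfl⟩⟩

instance TermC.var (x : β) : TermC k 𝓜 (fun _ (V : β → _) => V x) := ⟨.inl ⟨x, rfl⟩⟩

instance TermC.const (c : ∀ i, (𝓜 i).classes) : TermC True 𝓜 (fun i (_ : β → _) => c i) :=
  ⟨.inr ⟨trivial, c, rfl⟩⟩

theorem Dfn.rename {α' β' : Type} {R : ∀ i, (α → (𝓜 i).Obj) → (β → (𝓜 i).classes) → Prop}
    (h : Dfn k 𝓜 R) (f : α → α') (g : β → β') :
    Dfn k 𝓜 (fun i v V => R i (fun x => v (f x)) (fun X => V (g X))) := by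
  obtain ⟨γ, δ, hγ, hδ, hk, p, P, φ, hφ⟩ := h
  refine ⟨γ, δ, hγ, hδ, hk, p, P, φ.rename (Sum.map f id) (Sum.map g id), fun i v V => ?_⟩
  rw [sat_rename, ← hφ]
  refine iff_of_eq ?_
  congr 1 <;> (funext x; cases x <;> rfl)

theorem Dfn.congr {R S : ∀ i, (α → (𝓜 i).Obj) → (β → (𝓜 i).classes) → Prop}
    (h : Dfn k 𝓜 R) (e : ∀ i v V, R i v V ↔ S i v V) : Dfn k 𝓜 S := by
  have : R = S := by funext i v V; exact propext (e i v V)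
  exact this ▸ h

theorem Dfn.of_formula (φ : Fml α β) : Dfn k 𝓜 (fun i v V => (𝓜 i).Sat φ v V) :=
  ⟨Empty, Empty, inferInstance, inferInstance, by simp, fun _ => Empty.elim, fun _ => Empty.elim,
    φ.rename Sum.inl Sum.inl, fun i v V => by rw [sat_rename]; rfl⟩

/-- Substitution of variables and parameters for the variables of a definable relation. -/
theorem Dfn.subst {m n : Type} [Finite m] [Finite n]
    {R : ∀ i, (m → (𝓜 i).Obj) → (n → (𝓜 i).classes) → Prop}
    (h : Dfn k 𝓜 R) (f : m → ∀ i, (α → (𝓜 i).Obj) → (𝓜 i).Obj)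
    (F : n → ∀ i, (β → (𝓜 i).classes) → (𝓜 i).classes)
    (hf : ∀ j, TermO k 𝓜 (f j)) (hF : ∀ j, TermC k 𝓜 (F j)) :
    Dfn k 𝓜 (fun i v V => R i (fun j => f j i v) (fun j => F j i V)) := by
  classical
  obtain ⟨γ, δ, hγ, hδ, hk, p, P, φ, hφ⟩ := h
  -- The positions filled by constants index the new parameters; at every other position the term is
  -- a variable.
  let cO (j : m) : Prop := k ∧ ∃ c : ∀ i, (𝓜 i).Obj, f j = fun i _ => c i
  let cC (j : n) : Prop := k ∧ ∃ c : ∀ i, (𝓜 i).classes, F j = fun i _ => c i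
  have vO (j : m) (hj : ¬ cO j) : ∃ x, f j = fun _ v => v x := (hf j).out.resolve_right hj
  have vC (j : n) (hj : ¬ cC j) : ∃ x, F j = fun _ v => v x := (hF j).out.resolve_right hj
  refine ⟨γ ⊕ {j // cO j}, δ ⊕ {j // cC j}, inferInstance, inferInstance, ?_,
    fun i => Sum.elim (p i) (fun j => j.2.2.choose i),
    fun i => Sum.elim (P i) (fun j => j.2.2.choose i),
    φ.rename
      (Sum.elim (fun j => if h : cO j then .inr (.inr ⟨j, h⟩) else .inl (vO j h).choose)
        (.inr ∘ .inl))
      (Sum.elim (fun j => if h : cC j then .inr (.inr ⟨j, h⟩) else .inl (vC j h).choose)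
        (.inr ∘ .inl)), fun i v V => ?_⟩
  · rintro (⟨j | j⟩ | ⟨j | j⟩)
    exacts [hk (.inl ⟨j⟩), j.2.1, hk (.inr ⟨j⟩), j.2.1]
  · rw [sat_rename, ← hφ]
    refine iff_of_eq ?_
    congr 1
    · funext x
      rcases x with j | x
      · by_cases h : cO j
        · simpa [h] using (congrFun (congrFun h.2.choose_spec i) v).symm
        · simpa [h] using (congrFun (congrFun (vO j h).choose_spec i) v).symm
      · rfl
    · funext x
      rcases x with j | x
      · by_cases h : cC j
        · simpa [h] using (congrFun (congrFun h.2.choose_spec i) V).symm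
        · simpa [h] using (congrFun (congrFun (vC j h).choose_spec i) V).symm
      · rfl

section Terms

variable {f g h : ∀ i, (α → (𝓜 i).Obj) → (𝓜 i).Obj}
  {F G : ∀ i, (β → (𝓜 i).classes) → (𝓜 i).classes}

/-- With the substitution lemmas a defined notion needs to be shown definable only at the variables
0, 1, 2; arbitrary terms follow. -/
theorem Dfn.subst₁ {R : ∀ i, (𝓜 i).Obj → Prop}
    (H : Dfn k 𝓜 (α := Fin 1) (β := Empty) fun i v _ => R i (v 0)) [hf : TermO k 𝓜 f] :
    Dfn k 𝓜 (fun i v (_ : β → _) => R i (f i v)) :=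
  H.subst ![f] (fun x => x.elim) (by rintro ⟨_ | _, _⟩; assumption; omega) (fun x => x.elim)

theorem Dfn.subst₂ {R : ∀ i, (𝓜 i).Obj → (𝓜 i).Obj → Prop}
    (H : Dfn k 𝓜 (α := Fin 2) (β := Empty) fun i v _ => R i (v 0) (v 1))
    [hf : TermO k 𝓜 f] [hg : TermO k 𝓜 g] :
    Dfn k 𝓜 (fun i v (_ : β → _) => R i (f i v) (g i v)) :=
  H.subst ![f, g] (fun x => x.elim) (Fin.forall_fin_two.2 ⟨hf, hg⟩) (fun x => x.elim)

theorem Dfn.subst₃ {R : ∀ i, (𝓜 i).Obj → (𝓜 i).Obj → (𝓜 i).Obj → Prop}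
    (H : Dfn k 𝓜 (α := Fin 3) (β := Empty) fun i v _ => R i (v 0) (v 1) (v 2))
    [hf : TermO k 𝓜 f] [hg : TermO k 𝓜 g] [hh : TermO k 𝓜 h] :
    Dfn k 𝓜 (fun i v (_ : β → _) => R i (f i v) (g i v) (h i v)) :=
  H.subst ![f, g, h] (fun x => x.elim)
    (Fin.forall_fin_succ.2 ⟨hf, Fin.forall_fin_two.2 ⟨hg, hh⟩⟩) (fun x => x.elim)

theorem Dfn.substC₂ {R : ∀ i, (𝓜 i).classes → (𝓜 i).classes → Prop}
    (H : Dfn k 𝓜 (α := Empty) (β := Fin 2) fun i _ V => R i (V 0) (V 1))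
    [hF : TermC k 𝓜 F] [hG : TermC k 𝓜 G] :
    Dfn k 𝓜 (fun i (_ : α → _) V => R i (F i V) (G i V)) :=
  H.subst (fun x => x.elim) ![F, G] (fun x => x.elim) (Fin.forall_fin_two.2 ⟨hF, hG⟩)

theorem Dfn.subst₁C {R : ∀ i, (𝓜 i).Obj → (𝓜 i).classes → Prop}
    (H : Dfn k 𝓜 (α := Fin 1) (β := Fin 1) fun i v V => R i (v 0) (V 0))
    [hf : TermO k 𝓜 f] [hF : TermC k 𝓜 F] :
    Dfn k 𝓜 (fun i v V => R i (f i v) (F i V)) :=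
  H.subst ![f] ![F] (by rintro ⟨_ | _, _⟩; assumption; omega)
    (by rintro ⟨_ | _, _⟩; assumption; omega)

theorem Dfn.subst₂C {R : ∀ i, (𝓜 i).Obj → (𝓜 i).Obj → (𝓜 i).classes → Prop}
    (H : Dfn k 𝓜 (α := Fin 2) (β := Fin 1) fun i v V => R i (v 0) (v 1) (V 0))
    [hf : TermO k 𝓜 f] [hg : TermO k 𝓜 g] [hF : TermC k 𝓜 F] :
    Dfn k 𝓜 (fun i v V => R i (f i v) (g i v) (F i V)) :=
  H.subst ![f, g] ![F] (Fin.forall_fin_two.2 ⟨hf, hg⟩) (by rintro ⟨_ | _, _⟩; assumption; omega)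

instance Dfn.eqO [TermO k 𝓜 f] [TermO k 𝓜 g] :
    Dfn k 𝓜 (fun i v (_ : β → _) => f i v = g i v) :=
  .subst₂ (R := fun _ x y => x = y) (.of_formula (.eqO 0 1 : Fml (Fin 2) Empty))

instance Dfn.memO [TermO k 𝓜 f] [TermO k 𝓜 g] :
    Dfn k 𝓜 (fun i v (_ : β → _) => (𝓜 i).mem (f i v) (g i v)) :=
  .subst₂ (R := fun i x y => (𝓜 i).mem x y) (.of_formula (.memO 0 1 : Fml (Fin 2) Empty))

instance Dfn.ur [TermO k 𝓜 f] :
    Dfn k 𝓜 (fun i v (_ : β → _) => (𝓜 i).ur (f i v)) :=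
  .subst₁ (R := fun i x => (𝓜 i).ur x) (.of_formula (.ur 0 : Fml (Fin 1) Empty))

instance Dfn.memC [TermO k 𝓜 f] [TermC k 𝓜 F] :
    Dfn k 𝓜 (fun i v V => f i v ∈ (F i V : Set (𝓜 i).Obj)) :=
  .subst₁C (R := fun i x X => x ∈ (X : Set (𝓜 i).Obj)) (.of_formula (.memC 0 0 : Fml (Fin 1) (Fin 1)))

end Terms

instance Dfn.not {P : ∀ i, (α → (𝓜 i).Obj) → (β → (𝓜 i).classes) → Prop} [h : Dfn k 𝓜 P] :
    Dfn k 𝓜 (fun i v V => ¬ P i v V) := by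
  obtain ⟨γ, δ, hγ, hδ, hk, p, P, φ, hφ⟩ := h
  exact ⟨γ, δ, hγ, hδ, hk, p, P, φ.neg, fun i v V => not_congr (hφ i v V)⟩

instance Dfn.and {P Q : ∀ i, (α → (𝓜 i).Obj) → (β → (𝓜 i).classes) → Prop} [h : Dfn k 𝓜 P]
    [h' : Dfn k 𝓜 Q] : Dfn k 𝓜 (fun i v V => P i v V ∧ Q i v V) := by
  obtain ⟨γ, δ, hγ, hδ, hk, p, P, φ, hφ⟩ := h
  obtain ⟨γ', δ', hγ', hδ', hk', p', P', φ', hφ'⟩ := h'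
  refine ⟨γ ⊕ γ', δ ⊕ δ', inferInstance, inferInstance, ?_, fun i => Sum.elim (p i) (p' i),
    fun i => Sum.elim (P i) (P' i),
    .and (φ.rename (Sum.map id .inl) (Sum.map id .inl))
      (φ'.rename (Sum.map id .inr) (Sum.map id .inr)), fun i v V => ?_⟩
  · simp only [nonempty_sum]; tauto
  · rw [← hφ, ← hφ']
    refine and_congr ?_ ?_ <;>
    · rw [sat_rename]
      refine iff_of_eq ?_
      congr 1 <;> (funext x; rcases x with x | x <;> rfl)

/-- The bound variable is the new index `none`, so the body is a relation in one more free variable.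
-/
instance Dfn.exO {P : ∀ i, (𝓜 i).Obj → (α → (𝓜 i).Obj) → (β → (𝓜 i).classes) → Prop}
    [h : Dfn k 𝓜 (α := Option α) (fun i v V => P i (v none) (fun x => v (some x)) V)] :
    Dfn k 𝓜 (fun i v V => ∃ a, P i a v V) := by
  obtain ⟨γ, δ, hγ, hδ, hk, p, P', φ, hφ⟩ := h
  refine ⟨γ, δ, hγ, hδ, hk, p, P', .exO (φ.rename
    (Sum.elim (fun y => y.elim none (some ∘ .inl)) (some ∘ .inr)) id), fun i v V => ?_⟩
  refine exists_congr fun a => ?_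
  rw [sat_rename]
  refine Iff.trans (iff_of_eq ?_) (hφ i (fun y => y.elim a v) V)
  congr 1
  funext x; rcases x with (_ | x) | x <;> rfl

instance Dfn.exC' {P : ∀ i, (𝓜 i).classes → (α → (𝓜 i).Obj) → (β → (𝓜 i).classes) → Prop}
    [h : Dfn k 𝓜 (β := Option β) (fun i v V => P i (V none) v (fun x => V (some x)))] :
    Dfn k 𝓜 (fun i v V => ∃ A : (𝓜 i).classes, P i A v V) := by
  obtain ⟨γ, δ, hγ, hδ, hk, p, P', φ, hφ⟩ := h
  refine ⟨γ, δ, hγ, hδ, hk, p, P', .exC (φ.rename id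
    (Sum.elim (fun y => y.elim none (some ∘ .inl)) (some ∘ .inr))), fun i v V => ?_⟩
  refine exists_congr fun a => ?_
  rw [sat_rename]
  refine Iff.trans (iff_of_eq ?_) (hφ i v (fun y => y.elim a V))
  congr 1
  funext x; rcases x with (_ | x) | x <;> rfl

section Connectives

variable {P Q : ∀ i, (α → (𝓜 i).Obj) → (β → (𝓜 i).classes) → Prop}

instance Dfn.or [Dfn k 𝓜 P] [Dfn k 𝓜 Q] : Dfn k 𝓜 (fun i v V => P i v V ∨ Q i v V) :=
  Dfn.congr (R := fun i v V => ¬ (¬ P i v V ∧ ¬ Q i v V)) inferInstance (by intros; tauto)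

instance Dfn.imp [Dfn k 𝓜 P] [Dfn k 𝓜 Q] : Dfn k 𝓜 (fun i v V => P i v V → Q i v V) :=
  Dfn.congr (R := fun i v V => ¬ P i v V ∨ Q i v V) inferInstance (by intros; tauto)

instance Dfn.iff [Dfn k 𝓜 P] [Dfn k 𝓜 Q] : Dfn k 𝓜 (fun i v V => P i v V ↔ Q i v V) :=
  Dfn.congr (R := fun i v V => (P i v V → Q i v V) ∧ (Q i v V → P i v V)) inferInstance
    (by intros; tauto)

end Connectives

instance Dfn.allO {P : ∀ i, (𝓜 i).Obj → (α → (𝓜 i).Obj) → (β → (𝓜 i).classes) → Prop}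
    [Dfn k 𝓜 (α := Option α) (fun i v V => P i (v none) (fun x => v (some x)) V)] :
    Dfn k 𝓜 (fun i v V => ∀ a, P i a v V) :=
  Dfn.congr (R := fun i v V => ¬ ∃ a, ¬ P i a v V) inferInstance (by intros; push Not; rfl)

instance Dfn.exUniqueO {P : ∀ i, (𝓜 i).Obj → (α → (𝓜 i).Obj) → (β → (𝓜 i).classes) → Prop}
    [Dfn k 𝓜 (α := Option α) (fun i v V => P i (v none) (fun x => v (some x)) V)]
    [Dfn k 𝓜 (α := Option (Option α))
      (fun i v V => P i (v none) (fun x => v (some (some x))) V)] :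
    Dfn k 𝓜 (fun i v V => ∃! a, P i a v V) :=
  Dfn.congr (R := fun i v V => ∃ a, P i a v V ∧ ∀ b, P i b v V → b = a) inferInstance
    (by intros; rfl)

instance Dfn.true : Dfn k 𝓜 (fun _ (_ : α → _) (_ : β → _) => True) :=
  Dfn.congr (R := fun i _ _ => ∀ x : (𝓜 i).Obj, x = x) inferInstance (by simp)

instance Dfn.allC' {P : ∀ i, (𝓜 i).classes → (α → (𝓜 i).Obj) → (β → (𝓜 i).classes) → Prop}
    [Dfn k 𝓜 (β := Option β) (fun i v V => P i (V none) v (fun x => V (some x)))] :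
    Dfn k 𝓜 (fun i v V => ∀ A : (𝓜 i).classes, P i A v V) :=
  Dfn.congr (R := fun i v V => ¬ ∃ A : (𝓜 i).classes, ¬ P i A v V) inferInstance
    (by intros; push Not; rfl)

instance Dfn.allC {P : ∀ i, Set (𝓜 i).Obj → (α → (𝓜 i).Obj) → (β → (𝓜 i).classes) → Prop}
    [Dfn k 𝓜 (β := Option β) (fun i v V => P i (V none) v (fun x => V (some x)))] :
    Dfn k 𝓜 (fun i v V => ∀ A ∈ (𝓜 i).classes, P i A v V) :=
  (Dfn.allC' (P := fun i A v V => P i A v V)).congr fun _ _ _ =>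
    ⟨fun h A hA => h ⟨A, hA⟩, fun h A => h A A.2⟩

section Basic

variable {f g h : ∀ i, (α → (𝓜 i).Obj) → (𝓜 i).Obj}
  {F G : ∀ i, (β → (𝓜 i).classes) → (𝓜 i).classes}

instance Dfn.isSet [TermO k 𝓜 f] : Dfn k 𝓜 (fun i v (_ : β → _) => (𝓜 i).IsSet (f i v)) :=
  .not

instance Dfn.isEmptySet [TermO k 𝓜 f] :
    Dfn k 𝓜 (fun i v (_ : β → _) => (𝓜 i).IsEmptySet (f i v)) :=
  .subst₁ (R := fun i x => (𝓜 i).IsEmptySet x) (by unfold IsEmptySet; infer_instance)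

instance Dfn.isUPair [TermO k 𝓜 f] [TermO k 𝓜 g] [TermO k 𝓜 h] :
    Dfn k 𝓜 (fun i v (_ : β → _) => (𝓜 i).IsUPair (f i v) (g i v) (h i v)) :=
  .subst₃ (R := fun i x y z => (𝓜 i).IsUPair x y z) (by unfold IsUPair; infer_instance)

instance Dfn.isOPair [TermO k 𝓜 f] [TermO k 𝓜 g] [TermO k 𝓜 h] :
    Dfn k 𝓜 (fun i v (_ : β → _) => (𝓜 i).IsOPair (f i v) (g i v) (h i v)) :=
  .subst₃ (R := fun i x y z => (𝓜 i).IsOPair x y z) (by unfold IsOPair; infer_instance)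

instance Dfn.isOne [TermO k 𝓜 f] :
    Dfn k 𝓜 (fun i v (_ : β → _) => (𝓜 i).IsOne (f i v)) :=
  .subst₁ (R := fun i x => (𝓜 i).IsOne x) (by unfold IsOne; infer_instance)

instance Dfn.pairInClass [TermO k 𝓜 f] [TermO k 𝓜 g] [TermC k 𝓜 F] :
    Dfn k 𝓜 (fun i v V => (𝓜 i).PairInClass (F i V) (f i v) (g i v)) :=
  .subst₂C (R := fun i x y X => (𝓜 i).PairInClass X x y)
    (by unfold PairInClass; infer_instance)

instance Dfn.pairInSet [TermO k 𝓜 f] [TermO k 𝓜 g] [TermO k 𝓜 h] :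
    Dfn k 𝓜 (fun i v (_ : β → _) => (𝓜 i).PairInSet (f i v) (g i v) (h i v)) :=
  .subst₃ (R := fun i x y z => (𝓜 i).PairInSet x y z) (by unfold PairInSet; infer_instance)

instance Dfn.sub [TermO k 𝓜 f] [TermO k 𝓜 g] :
    Dfn k 𝓜 (fun i v (_ : β → _) => (𝓜 i).Sub (f i v) (g i v)) :=
  .subst₂ (R := fun i x y => (𝓜 i).Sub x y) (by unfold Sub; infer_instance)

instance Dfn.isTransSet [TermO k 𝓜 f] :
    Dfn k 𝓜 (fun i v (_ : β → _) => (𝓜 i).IsTransSet (f i v)) :=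
  .subst₁ (R := fun i x => (𝓜 i).IsTransSet x) (by unfold IsTransSet; infer_instance)

instance Dfn.isPure [TermO k 𝓜 f] :
    Dfn k 𝓜 (fun i v (_ : β → _) => (𝓜 i).IsPure (f i v)) :=
  .subst₁ (R := fun i x => (𝓜 i).IsPure x) (by unfold IsPure InTrcSingleton; infer_instance)

instance Dfn.isUrDomain [TermC k 𝓜 F] [TermC k 𝓜 G] :
    Dfn k 𝓜 (fun i (_ : α → _) V => (𝓜 i).IsUrDomain (F i V) (G i V)) :=
  have H : Dfn k 𝓜 (α := Empty) (β := Fin 2) fun i _ V => (𝓜 i).IsUrDomain (V 0) (V 1) := by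
    simp only [IsUrDomain, Subtype.coe_prop, true_and]; infer_instance
  .substC₂ (R := fun i (X Y : (𝓜 i).classes) => (𝓜 i).IsUrDomain X Y) H

end Basic

theorem Dfn.all_finite {κ : Type} [Finite κ]
    {P : κ → ∀ i, (α → (𝓜 i).Obj) → (β → (𝓜 i).classes) → Prop} (h : ∀ j, Dfn k 𝓜 (P j)) :
    Dfn k 𝓜 (fun i v V => ∀ j, P j i v V) := by
  revert P
  induction κ using Finite.induction_empty_option with
  | @of_equiv κ κ' f ih =>
    intro P h
    exact (ih fun j => h (f j)).congr fun i v V => f.forall_congr_right (q := fun j => P j i v V)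
  | h_empty =>
    intro P _
    exact Dfn.congr (R := fun _ _ _ => True) inferInstance fun i v V => by simp
  | @h_option κ _ ih =>
    intro P h
    have := ih fun j => h (some j)
    have := h none
    exact Dfn.congr (R := fun i v V => P none i v V ∧ ∀ j, P (some j) i v V) inferInstance
      fun i v V => by rw [Option.forall]

/-- A relation defined without parameters is defined by a formula. -/
theorem Dfn.exists_formula {R : ∀ i, (α → (𝓜 i).Obj) → (β → (𝓜 i).classes) → Prop}
    (h : Dfn False 𝓜 R) : ∃ φ : Fml α β, ∀ i v V, (𝓜 i).Sat φ v V ↔ R i v V := by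
  obtain ⟨γ, δ, _, _, hk, p, P, φ, hφ⟩ := h
  have : IsEmpty γ := ⟨fun x => hk (.inl ⟨x⟩)⟩
  have : IsEmpty δ := ⟨fun x => hk (.inr ⟨x⟩)⟩
  refine ⟨φ.rename (Sum.elim id isEmptyElim) (Sum.elim id isEmptyElim), fun i v V => ?_⟩
  rw [← hφ, sat_rename]
  refine iff_of_eq ?_
  congr 1 <;> (funext x; rcases x with x | x; rfl; exact isEmptyElim x)

end Dfn

/-- `P` is definable in `M` with parameters. -/
abbrev DfnPred (M : ClassModel.{u}) (P : M.Obj → Prop) : Prop :=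
  Dfn True (fun _ : Unit => M) (α := Unit) (β := Empty) (fun _ v _ => P (v ()))

/-- The binary relation `P` is definable in `M` with parameters. -/
abbrev DfnRel (M : ClassModel.{u}) (P : M.Obj → M.Obj → Prop) : Prop :=
  Dfn True (fun _ : Unit => M) (α := Fin 2) (β := Empty) (fun _ v _ => P (v 0) (v 1))

/-- The finitely many parameters are renumbered by `Fin m` and `Fin n`, the only index types that
the axiom mentions. -/
theorem FullComprehension.exists_class {M : ClassModel.{u}} (hM : M.FullComprehension)
    (P : M.Obj → Prop) [h : M.DfnPred P] : ∃ C : M.classes, ∀ x, x ∈ (C : Set M.Obj) ↔ P x := by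
  obtain ⟨γ, δ, _, _, -, p, Q, φ, hφ⟩ := h
  obtain ⟨m, ⟨eγ⟩⟩ := Finite.exists_equiv_fin γ
  obtain ⟨n, ⟨eδ⟩⟩ := Finite.exists_equiv_fin δ
  refine ⟨⟨_, hM m n (φ.rename (Sum.elim (fun _ => none) (some ∘ eγ)) (Sum.elim Empty.elim eδ))
    (p () ∘ eγ.symm) (Q () ∘ eδ.symm)⟩, fun x => ?_⟩
  refine Iff.trans ?_ (hφ () (fun _ => x) Empty.elim)
  rw [Set.mem_ofPred_eq, sat_rename]
  refine iff_of_eq ?_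
  congr 1
  · funext y; rcases y with y | y <;> simp
  · funext y; rcases y with y | y
    · exact y.elim
    · simp

end ClassModel

/-! ### Consequences of RP₂: the axioms of KMU other than Choice, and fixed points. -/

namespace ClassModel

/-- A fragment of `KMU + RP₂` from which all axioms but Choice follow. -/
structure Core (M : ClassModel.{u}) : Prop where
  ur_no_mem : ∀ x, M.ur x → ¬ ∃ y, M.mem y x
  ext : ∀ x y, M.IsSet x → M.IsSet y → (∀ z, M.mem z y ↔ M.mem z x) → x = y
  foundation : ∀ x, (∃ y, M.mem y x) → ∃ z, M.mem z x ∧ ¬ ∃ w, M.mem w z ∧ M.mem w x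
  separation : ∀ Y ∈ M.classes, ∀ x, M.IsSet x →
    ∃ y, M.IsSet y ∧ ∀ z, M.mem z y ↔ z ∈ Y ∧ M.mem z x
  comprehension : M.FullComprehension
  rp2 : M.RP2

theorem IsKMU.core {M : ClassModel.{u}} (h : M.IsKMU) (h' : M.RP2) : M.Core :=
  ⟨h.ur_no_mem, h.ext, h.foundation, h.separation, h.comprehension, h'⟩

section Absoluteness

variable {M : ClassModel.{u}} {t : M.Obj}

theorem IsTransSet.mem (ht : M.IsTransSet t) {x y : M.Obj} (hx : M.mem x t) (hy : M.mem y x) :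
    M.mem y t := ht.2 x hx y hy

theorem below_ext {a b : (M.below t).Obj} : a = b ↔ a.1 = b.1 := Subtype.ext_iff

/-- By transitivity all members of `z` lie in `t`, so restricting the quantifier to `t` loses
nothing. -/
theorem below_isUPair (ht : M.IsTransSet t) (z a b : (M.below t).Obj) :
    (M.below t).IsUPair z a b ↔ M.IsUPair z.1 a.1 b.1 := by
  refine and_congr Iff.rfl ⟨fun h v => ⟨fun hv => ?_, fun hv => ?_⟩, fun h v => ?_⟩
  · exact ((h ⟨v, ht.mem z.2 hv⟩).1 hv).imp below_ext.1 below_ext.1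
  · have : M.mem v t := by rcases hv with rfl | rfl; exacts [a.2, b.2]
    exact (h ⟨v, this⟩).2 (hv.imp below_ext.2 below_ext.2)
  · rw [below_ext, below_ext]; exact h v.1

theorem below_isOPair (ht : M.IsTransSet t) (z a b : (M.below t).Obj) :
    (M.below t).IsOPair z a b ↔ M.IsOPair z.1 a.1 b.1 := by
  constructor
  · rintro ⟨s, d, h₁, h₂, h₃⟩
    rw [below_isUPair ht] at h₁ h₂ h₃
    exact ⟨s.1, d.1, h₁, h₂, h₃⟩
  · rintro ⟨s, d, h₁, h₂, h₃⟩
    exact ⟨⟨s, ht.mem z.2 ((h₃.2 s).2 (.inl rfl))⟩, ⟨d, ht.mem z.2 ((h₃.2 d).2 (.inr rfl))⟩,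
      (below_isUPair ht _ _ _).2 h₁, (below_isUPair ht _ _ _).2 h₂, (below_isUPair ht _ _ _).2 h₃⟩

/-- `t` is a transitive set that is closed under unordered pairs. -/
structure IsNice (M : ClassModel.{u}) (t : M.Obj) : Prop where
  trans : M.IsTransSet t
  pair : ∀ a b, M.mem a t → M.mem b t → ∃ z, M.mem z t ∧ M.IsUPair z a b

end Absoluteness

namespace Core

variable {M : ClassModel.{u}} (hM : M.Core)
include hM

/-- The intersection of a class with a transitive set `t`, as a class of `M.below t`. -/
def trace (t : M.Obj) (ht : M.IsTransSet t) (X : M.classes) : (M.below t).classes :=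
  ⟨{x | x.1 ∈ (X : Set M.Obj)}, by
    obtain ⟨s, hs, h⟩ := hM.separation X X.2 t ht.1
    exact ⟨s, hs, fun z hz => ((h z).1 hz).2, fun x => ((h x.1).trans (and_iff_left x.2)).symm⟩⟩

theorem exists_class (P : M.Obj → Prop) [M.DfnPred P] :
    ∃ C : M.classes, ∀ x, x ∈ (C : Set M.Obj) ↔ P x :=
  hM.comprehension.exists_class P

theorem exists_sep {x : M.Obj} (hx : M.IsSet x) (P : M.Obj → Prop) [M.DfnPred P]
    (h : ∀ z, P z → M.mem z x) : ∃ y, M.IsSet y ∧ ∀ z, M.mem z y ↔ P z := by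
  obtain ⟨C, hC⟩ := hM.exists_class P
  obtain ⟨y, hy, h'⟩ := hM.separation C C.2 x hx
  exact ⟨y, hy, fun z => by rw [h', hC]; exact ⟨And.left, fun hz => ⟨hz, h z hz⟩⟩⟩

theorem exists_trans_sat {β : Type} [Finite β] (φ : Fml Empty β) (X : β → M.classes)
    (h : M.Sat φ Empty.elim X) : ∃ (t : M.Obj) (ht : M.IsTransSet t),
      (M.below t).Sat φ Empty.elim (fun j => hM.trace t ht (X j)) := by
  obtain ⟨n, ⟨f⟩⟩ := Finite.exists_equiv_fin β
  obtain ⟨t, ht, Y, hY, hS⟩ := hM.rp2 n (φ.rename id f) (fun j => X (f.symm j)) (by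
    rw [sat_rename]; simpa using h)
  refine ⟨t, ht, ?_⟩
  rw [sat_rename] at hS
  convert hS using 2 with j
  ext z
  have := hY (f j) z
  rw [Equiv.symm_apply_apply] at this
  exact this.symm

/-- RP₂ has class parameters only, so `a` and `b` enter as the classes {a} and {b}. The reflected
formula says that these classes have members satisfying `R`; below `t` the witnesses can only be `a`
and `b`, which forces both into `t`. -/
theorem reflect_trans {β : Type} [Finite β]
    (R : ∀ N : ClassModel.{u}, N.Obj → N.Obj → (β → N.classes) → Prop)
    [hR : Dfn False (fun N : ClassModel.{u} => N) (α := Fin 2) (β := β)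
      fun N v V => R N (v 0) (v 1) V]
    {a b : M.Obj} {V : β → M.classes} (h : R M a b V) :
    ∃ (t : M.Obj) (ht : M.IsTransSet t) (ha : M.mem a t) (hb : M.mem b t),
      R (M.below t) ⟨a, ha⟩ ⟨b, hb⟩ (fun j => hM.trace t ht (V j)) := by
  obtain ⟨A, hA⟩ := hM.exists_class (fun x => x = a)
  obtain ⟨B, hB⟩ := hM.exists_class (fun x => x = b)
  have H : Dfn False (fun N : ClassModel.{u} => N) (α := Option (Option Empty))
      (β := Option (Option β))
      fun N v V => R N (v (some none)) (v none) (fun j => V (some (some j))) :=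
    hR.rename ![some none, none] (fun j => some (some j))
  obtain ⟨φ, hφ⟩ := Dfn.exists_formula (𝓜 := fun N : ClassModel.{u} => N)
    (α := Empty) (β := Option (Option β))
    (R := fun N _ V => ∃ x, ∃ y, R N x y (fun j => V (some (some j))) ∧
      x ∈ (V none : Set N.Obj) ∧ y ∈ (V (some none) : Set N.Obj)) inferInstance
  obtain ⟨t, ht, hS⟩ := hM.exists_trans_sat φ (fun j => j.elim A (fun j => j.elim B V))
    ((hφ ..).2 ⟨a, b, h, (hA a).2 rfl, (hB b).2 rfl⟩)
  obtain ⟨⟨x, hx⟩, ⟨y, hy⟩, h', hxA, hyB⟩ := (hφ ..).1 hS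
  obtain rfl := (hA x).1 hxA
  obtain rfl := (hB y).1 hyB
  exact ⟨t, ht, hx, hy, h'⟩

/-- A trivial statement is reflected; the gain is that `t` contains `a` and `b`. -/
theorem exists_trans (a b : M.Obj) : ∃ t, M.IsTransSet t ∧ M.mem a t ∧ M.mem b t := by
  obtain ⟨t, ht, ha, hb, -⟩ := hM.reflect_trans (β := Empty) (a := a) (b := b) (V := Empty.elim)
    (fun N x _ _ => x = x) rfl
  exact ⟨t, ht, ha, hb⟩

theorem isSet_of_mem {x y : M.Obj} (h : M.mem x y) : M.IsSet y :=
  fun h' => hM.ur_no_mem y h' ⟨x, h⟩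

theorem exists_upair (a b : M.Obj) : ∃ z, M.IsUPair z a b := by
  obtain ⟨t, ht, ha, hb⟩ := hM.exists_trans a b
  exact hM.exists_sep ht.1 (fun v => v = a ∨ v = b) (by rintro z (rfl | rfl) <;> assumption)

/-- Pairing is reflected along with `R`. A `t` closed under pairs contains the ordered pairs of its
members, which makes `PairInClass` absolute between `M.below t` and `M`. -/
theorem reflect {β : Type} [Finite β]
    (R : ∀ N : ClassModel.{u}, N.Obj → N.Obj → (β → N.classes) → Prop)
    [hR : Dfn False (fun N : ClassModel.{u} => N) (α := Fin 2) (β := β)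
      fun N v V => R N (v 0) (v 1) V]
    {a b : M.Obj} {V : β → M.classes} (h : R M a b V) :
    ∃ (t : M.Obj) (ht : M.IsNice t) (ha : M.mem a t) (hb : M.mem b t),
      R (M.below t) ⟨a, ha⟩ ⟨b, hb⟩ (fun j => hM.trace t ht.trans (V j)) := by
  obtain ⟨t, ht, ha, hb, h', hp⟩ := hM.reflect_trans
    (fun N x y V => R N x y V ∧ ∀ a b, ∃ z, N.IsUPair z a b) ⟨h, hM.exists_upair⟩
  refine ⟨t, ⟨ht, fun a b ha hb => ?_⟩, ha, hb, h'⟩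
  obtain ⟨z, hz⟩ := hp ⟨a, ha⟩ ⟨b, hb⟩
  exact ⟨z.1, z.2, (below_isUPair ht _ _ _).1 hz⟩

theorem exists_opair (a b : M.Obj) : ∃ z, M.IsOPair z a b := by
  obtain ⟨s, hs⟩ := hM.exists_upair a a
  obtain ⟨d, hd⟩ := hM.exists_upair a b
  obtain ⟨z, hz⟩ := hM.exists_upair s d
  exact ⟨z, s, d, hs, hd, hz⟩

theorem upair_unique {z z' a b : M.Obj} (h : M.IsUPair z a b) (h' : M.IsUPair z' a b) : z = z' :=
  hM.ext _ _ h.1 h'.1 fun v => by rw [h.2, h'.2]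

theorem opair_unique {z z' a b : M.Obj} (h : M.IsOPair z a b) (h' : M.IsOPair z' a b) :
    z = z' := by
  obtain ⟨s, d, h₁, h₂, h₃⟩ := h
  obtain ⟨s', d', h₁', h₂', h₃'⟩ := h'
  obtain rfl := hM.upair_unique h₁ h₁'
  obtain rfl := hM.upair_unique h₂ h₂'
  exact hM.upair_unique h₃ h₃'

omit hM in
theorem upair_inj {z a b c d : M.Obj} (h : M.IsUPair z a b) (h' : M.IsUPair z c d) :
    (a = c ∧ b = d) ∨ (a = d ∧ b = c) := by
  have H v : (v = a ∨ v = b) ↔ (v = c ∨ v = d) := (h.2 v).symm.trans (h'.2 v)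
  have h₁ := H a; have h₂ := H b; have h₃ := H c; have h₄ := H d
  grind

omit hM in
theorem opair_inj {z a b c d : M.Obj} (h : M.IsOPair z a b) (h' : M.IsOPair z c d) :
    a = c ∧ b = d := by
  obtain ⟨s, e, h₁, h₂, h₃⟩ := h
  obtain ⟨s', e', h₁', h₂', h₃'⟩ := h'
  rcases upair_inj h₃ h₃' with ⟨rfl, rfl⟩ | ⟨rfl, rfl⟩
  · have := upair_inj h₁ h₁'; have := upair_inj h₂ h₂'; grind
  · have := upair_inj h₁ h₂'; have := upair_inj h₂ h₁'; grind

theorem exists_rel (P : M.Obj → M.Obj → Prop) [hP : M.DfnRel P] :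
    ∃ F : M.classes, ∀ a b, M.PairInClass F a b ↔ P a b := by
  have : Dfn True (fun _ : Unit => M) (α := Option (Option Unit)) (β := Empty)
    (fun _ v _ => P (v (some none)) (v none)) := hP.rename ![some none, none] id
  obtain ⟨F, hF⟩ := hM.exists_class (fun z => ∃ a, ∃ b, M.IsOPair z a b ∧ P a b)
  refine ⟨F, fun a b => ⟨fun ⟨z, hz, h⟩ => ?_, fun h => ?_⟩⟩
  · obtain ⟨c, d, h', hP⟩ := (hF z).1 hz
    obtain ⟨rfl, rfl⟩ := opair_inj h h'
    exact hP
  · obtain ⟨z, hz⟩ := hM.exists_opair a b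
    exact ⟨z, (hF z).2 ⟨a, b, hz, h⟩, hz⟩

theorem opair_mem {t a b z : M.Obj} (ht : M.IsNice t) (ha : M.mem a t) (hb : M.mem b t)
    (h : M.IsOPair z a b) : M.mem z t := by
  obtain ⟨s, d, h₁, h₂, h₃⟩ := h
  obtain ⟨s', hs', h₁'⟩ := ht.pair _ _ ha ha
  obtain ⟨d', hd', h₂'⟩ := ht.pair _ _ ha hb
  obtain rfl := hM.upair_unique h₁ h₁'
  obtain rfl := hM.upair_unique h₂ h₂'
  obtain ⟨z', hz', h₃'⟩ := ht.pair _ _ hs' hd'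
  obtain rfl := hM.upair_unique h₃ h₃'
  exact hz'

theorem exists_nice (a : M.Obj) : ∃ t, M.IsNice t ∧ M.mem a t := by
  obtain ⟨t, ht, ha, -, -⟩ := hM.reflect (β := Empty) (a := a) (b := a) (V := Empty.elim)
    (fun N x _ _ => x = x) rfl
  exact ⟨t, ht, ha⟩

theorem below_pairInClass {t : M.Obj} (ht : M.IsNice t) (F : M.classes) (a b : (M.below t).Obj) :
    (M.below t).PairInClass (hM.trace t ht.trans F) a b ↔ M.PairInClass F a.1 b.1 := by
  constructor
  · rintro ⟨z, hz, h⟩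
    exact ⟨z.1, hz, (below_isOPair ht.trans _ _ _).1 h⟩
  · rintro ⟨z, hz, h⟩
    have hzt : M.mem z t := hM.opair_mem ht a.2 b.2 h
    exact ⟨⟨z, hzt⟩, hz, (below_isOPair ht.trans _ _ _).2 h⟩

/-- Foundation speaks of sets, so `C` is cut down to a transitive `t` containing `x`. A minimal
member of `C ∩ t` is minimal in `C`, because its members are again in `t`. -/
theorem wf (C : M.classes) {x : M.Obj} (hx : x ∈ (C : Set M.Obj)) :
    ∃ m ∈ (C : Set M.Obj), ∀ y, M.mem y m → y ∉ (C : Set M.Obj) := by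
  obtain ⟨t, ht, hxt, -⟩ := hM.exists_trans x x
  obtain ⟨s, hs, h⟩ := hM.separation C C.2 t ht.1
  obtain ⟨m, hm, hmin⟩ := hM.foundation s ⟨x, (h x).2 ⟨hx, hxt⟩⟩
  exact ⟨m, ((h m).1 hm).1, fun y hy hyC =>
    hmin ⟨y, hy, (h y).2 ⟨hyC, ht.2 _ ((h m).1 hm).2 _ hy⟩⟩⟩

theorem induct (P : M.Obj → Prop) [M.DfnPred P] (h : ∀ x, (∀ y, M.mem y x → P y) → P x)
    (x : M.Obj) : P x := by
  by_contra hx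
  obtain ⟨C, hC⟩ := hM.exists_class (fun x => ¬ P x)
  obtain ⟨m, hm, hmin⟩ := hM.wf C ((hC x).2 hx)
  exact (hC m).1 hm (h m fun y hy => by_contra fun hy' => hmin y hy ((hC y).2 hy'))

/-- The hypothesis, stated with `Q` as a class of pairs, reflects to a `t` containing `y`; the
witnesses found below `t` are members of `t`. -/
theorem collection (Q : M.Obj → M.Obj → Prop) [hQ : M.DfnRel Q] (y : M.Obj)
    (h : ∀ a, M.mem a y → ∃ b, Q a b) :
    ∃ t, M.IsNice t ∧ M.mem y t ∧ ∀ a, M.mem a y → ∃ b, M.mem b t ∧ Q a b := by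
  obtain ⟨F, hF⟩ := hM.exists_rel Q
  obtain ⟨t, ht, hy, -, H⟩ := hM.reflect (β := Unit) (a := y) (b := y) (V := fun _ => F)
    (fun N y _ V => ∀ a, N.mem a y → ∃ b, N.PairInClass (V ()) a b) (by simpa [hF] using h)
  refine ⟨t, ht, hy, fun a ha => ?_⟩
  obtain ⟨b, hb⟩ := H ⟨a, ht.trans.2 _ hy _ ha⟩ ha
  exact ⟨b.1, b.2, (hF _ _).1 ((hM.below_pairInClass ht F _ _).1 hb)⟩

/-- Replacement for definable relations. -/
theorem exists_image (Q : M.Obj → M.Obj → Prop) [hQ : M.DfnRel Q] (y : M.Obj)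
    (h : ∀ a, M.mem a y → ∃! b, Q a b) :
    ∃ z, M.IsSet z ∧ ∀ b, M.mem b z ↔ ∃ a, M.mem a y ∧ Q a b := by
  have : Dfn True (fun _ : Unit => M) (α := Option Unit) (β := Empty)
    (fun _ v _ => Q (v none) (v (some ()))) := hQ.rename ![none, some ()] id
  obtain ⟨t, ht, -, H⟩ := hM.collection Q y fun a ha => (h a ha).exists
  refine hM.exists_sep ht.trans.1 (fun b => ∃ a, M.mem a y ∧ Q a b) ?_
  rintro b ⟨a, ha, hab⟩
  obtain ⟨b', hb', hab'⟩ := H a ha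
  rwa [(h a ha).unique hab hab']

theorem exists_empty : ∃ e, M.IsEmptySet e := by
  -- Some object exists because RP₂, applied to a valid sentence, supplies a set.
  obtain ⟨x⟩ : Nonempty M.Obj := by
    obtain ⟨φ, hφ⟩ := Dfn.exists_formula (𝓜 := fun N : ClassModel.{u} => N)
      (α := Empty) (β := Fin 0) (R := fun N _ _ => ∀ x : N.Obj, x = x) inferInstance
    obtain ⟨t, -⟩ := hM.rp2 0 φ Fin.elim0 ((hφ ..).2 fun _ => rfl)
    exact ⟨t⟩
  obtain ⟨t, ht, -⟩ := hM.exists_trans x x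
  obtain ⟨e, he, h⟩ := hM.exists_sep ht.1 (fun x => ¬ x = x) (by simp)
  exact ⟨e, he, fun v => by simp [h]⟩

/-- The reflected statement is that every class included in `x` is co-extensional with a set. Every
subset of `t` is a class of `M.below t`, so every subset of `x` is co-extensional with a member of
`t`, hence is in `t`, and Separation applies. -/
theorem exists_power (x : M.Obj) : ∃ y, M.IsSet y ∧ ∀ z, M.mem z y ↔ M.IsSet z ∧ M.Sub z x := by
  obtain ⟨t, ht, hx, -, H⟩ := hM.reflect (β := Empty) (a := x) (b := x) (V := Empty.elim)
    (fun N x _ _ => ∀ A ∈ N.classes, (∀ z, z ∈ A → N.mem z x) →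
      ∃ s, N.IsSet s ∧ ∀ z, N.mem z s ↔ z ∈ A) (by
      intro A hA hAx
      by_cases hx : M.IsSet x
      · obtain ⟨y, hy, h⟩ := hM.separation A hA x hx
        exact ⟨y, hy, fun z => by rw [h]; exact ⟨And.left, fun hz => ⟨hz, hAx z hz⟩⟩⟩
      · obtain ⟨e, he, h⟩ := hM.exists_empty
        exact ⟨e, he, fun z => iff_of_false (h z) fun hz => hx (hM.isSet_of_mem (hAx z hz))⟩)
  refine hM.exists_sep ht.trans.1 (fun z => M.IsSet z ∧ M.Sub z x) fun z ⟨hz, hzx⟩ => ?_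
  obtain ⟨s, hs, h⟩ := H {y | M.mem y.1 z} ⟨z, hz, fun y hy => ht.trans.2 _ hx _ (hzx y hy),
    fun _ => Iff.rfl⟩ (fun y hy => hzx y.1 hy)
  rw [hM.ext z s.1 hz hs fun y => ⟨fun hy => (h ⟨y, ht.trans.2 _ s.2 _ hy⟩).1 hy,
    fun hy => (h ⟨y, ht.trans.2 _ hx _ (hzx y hy)⟩).2 hy⟩]
  exact s.2

theorem exists_union (x : M.Obj) :
    ∃ y, M.IsSet y ∧ ∀ z, M.mem z y ↔ ∃ w, M.mem w x ∧ M.mem z w := by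
  obtain ⟨t, ht, hx, -⟩ := hM.exists_trans x x
  exact hM.exists_sep ht.1 (fun z => ∃ w, M.mem w x ∧ M.mem z w)
    fun z ⟨w, hw, hz⟩ => ht.2 _ (ht.2 _ hx _ hw) _ hz

/-- A transitive set that reflects the existence of `x ∪ {x}` for all `x`, and contains the empty
set, is itself inductive. -/
theorem infinity : ∃ s, (∃ y, M.mem y s ∧ M.IsEmptySet y) ∧
    ∀ x, M.mem x s → ∃ y, M.mem y s ∧ M.IsSet y ∧ ∀ z, M.mem z y ↔ M.mem z x ∨ z = x := by
  obtain ⟨e, he⟩ := hM.exists_empty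
  obtain ⟨t, ht, h₁, -, h₂⟩ := hM.reflect (β := Empty) (a := e) (b := e) (V := Empty.elim)
    (fun N x _ _ => ∀ x, ∃ y, N.IsSet y ∧ ∀ z, N.mem z y ↔ N.mem z x ∨ z = x) (by
      intro x
      obtain ⟨t, ht, hx, -⟩ := hM.exists_trans x x
      exact hM.exists_sep ht.1 (fun z => M.mem z x ∨ z = x)
        (by rintro z (hz | rfl); exacts [ht.2 _ hx _ hz, hx]))
  refine ⟨t, ⟨e, h₁, he⟩, fun x hx => ?_⟩
  obtain ⟨y, hy, h⟩ := h₂ ⟨x, hx⟩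
  refine ⟨y.1, y.2, hy, fun z => ⟨fun hz => ?_, fun hz => ?_⟩⟩
  · exact ((h ⟨z, ht.trans.2 _ y.2 _ hz⟩).1 hz).imp id (congrArg Subtype.val)
  · have : M.mem z t := by rcases hz with hz | rfl; exacts [ht.trans.2 _ hx _ hz, hx]
    exact (h ⟨z, this⟩).2 (hz.imp id Subtype.ext)

theorem isKMU (h : M.AC) : M.IsKMU where
  ur_no_mem := hM.ur_no_mem
  ext := hM.ext
  foundation := hM.foundation
  pairing x y := (hM.exists_upair x y).imp fun _ h => h.2
  union x := (hM.exists_union x).imp fun _ h => h.2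
  powerset x := (hM.exists_power x).imp fun _ h => h.2
  infinity := hM.infinity
  separation := hM.separation
  replacement F hF x _ h := hM.exists_image (fun a b => M.PairInClass (⟨F, hF⟩ : M.classes) a b) x h
  comprehension := hM.comprehension
  choice := h

/-- Monotone definable operators on classes have fixed points. -/
theorem exists_fix (Φ : Set M.Obj → M.Obj → Prop)
    (mono : ∀ K K', K ⊆ K' → ∀ a, Φ K a → Φ K' a)
    [hΦ : Dfn True (fun _ : Unit => M) (α := Unit) (β := Unit) (fun _ v V => Φ (V ()) (v ()))] :
    ∃ H : M.classes, ∀ a, a ∈ (H : Set M.Obj) ↔ Φ H a := by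
  have : Dfn True (fun _ : Unit => M) (α := Option Unit) (β := Option Empty)
    (fun _ v V => Φ (V none) (v none)) := hΦ.rename (fun _ => none) (fun _ => none)
  have hΦ' (H : M.classes) : Dfn True (fun _ : Unit => M) (α := Unit) (β := Empty)
    (fun _ v V => Φ H (v ())) := hΦ.subst (fun _ _ v => v ()) (fun _ _ _ => H)
      inferInstance inferInstance
  -- As in the Knaster–Tarski theorem, `H` is the union of all classes `K` with `K ⊆ Φ K`. The class
  -- quantifier makes this an impredicative use of comprehension.
  obtain ⟨H, hH⟩ := hM.exists_class (fun x => ∃ K : M.classes, x ∈ (K : Set M.Obj) ∧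
    ∀ y, y ∈ (K : Set M.Obj) → Φ K y)
  have h₁ (a) (ha : a ∈ (H : Set M.Obj)) : Φ H a := by
    obtain ⟨K, haK, hK⟩ := (hH a).1 ha
    exact mono _ _ (fun x hx => (hH x).2 ⟨K, hx, hK⟩) _ (hK a haK)
  have := hΦ' H
  refine ⟨H, fun a => ⟨h₁ a, fun ha => (hH a).2 ?_⟩⟩
  -- Since `H ⊆ Φ H`, monotonicity shows that the class `Φ H` is one of those united in `H`.
  obtain ⟨K, hK⟩ := hM.exists_class (fun x => Φ H x)
  exact ⟨K, (hK a).2 ha, fun y hy => mono _ _ (fun x hx => (hK x).2 (h₁ x hx)) _ ((hK y).1 hy)⟩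

/-- Monotone definable operators on class relations have fixed points. -/
theorem exists_fixRel (Φ : (M.Obj → M.Obj → Prop) → M.Obj → M.Obj → Prop)
    (mono : ∀ K K' : M.Obj → M.Obj → Prop, (∀ a b, K a b → K' a b) → ∀ a b, Φ K a b → Φ K' a b)
    [hΦ : Dfn True (fun _ : Unit => M) (α := Fin 2) (β := Unit)
      (fun _ v V => Φ (M.PairInClass (V ())) (v 0) (v 1))] :
    ∃ H : M.classes, ∀ a b, M.PairInClass H a b ↔ Φ (M.PairInClass H) a b := by
  have : Dfn True (fun _ : Unit => M) (α := Option (Option Unit)) (β := Unit)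
    (fun _ v V => Φ (M.PairInClass (V ())) (v (some none)) (v none)) :=
    hΦ.rename ![some none, none] id
  obtain ⟨H, hH⟩ := hM.exists_fix
    (fun K z => ∃ a, ∃ b, M.IsOPair z a b ∧ Φ (M.PairInClass K) a b) (by
      rintro K K' h z ⟨a, b, hz, hab⟩
      exact ⟨a, b, hz, mono _ _ (fun x y ⟨w, hw, hxy⟩ => ⟨w, h hw, hxy⟩) _ _ hab⟩)
  refine ⟨H, fun a b => ⟨fun ⟨z, hz, h⟩ => ?_, fun h => ?_⟩⟩
  · obtain ⟨c, d, h', hP⟩ := (hH z).1 hz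
    obtain ⟨rfl, rfl⟩ := opair_inj h h'
    exact hP
  · obtain ⟨z, hz⟩ := hM.exists_opair a b
    exact ⟨z, (hH z).2 ⟨a, b, hz, h⟩, hz⟩

end Core
end ClassModel

/-! ### Structures realized inside a model: transfer of comprehension and reflection. -/

namespace ClassModel

/-- `e` embeds `N` into `M` as a class structure: `R` is the range of `e`, `E` codes the membership
relation and `U` consists of the urelements. -/
structure Embeds (M N : ClassModel.{u}) (e : N.Obj → M.Obj) (E R U : M.classes) : Prop where
  inj : Function.Injective e
  range : ∀ x, x ∈ (R : Set M.Obj) ↔ ∃ a, e a = x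
  mem : ∀ a b, N.mem a b ↔ M.PairInClass E (e a) (e b)
  ur : ∀ a, N.ur a ↔ e a ∈ (U : Set M.Obj)
  classes : ∀ Y, Y ∈ N.classes ↔ e '' Y ∈ M.classes

/-- The class of `M` that corresponds to a class of an embedded structure. -/
def Embeds.img {M N : ClassModel.{u}} {e : N.Obj → M.Obj} {E R U : M.classes}
    (h : M.Embeds N e E R U) (Y : N.classes) : M.classes := ⟨e '' Y, (h.classes _).1 Y.2⟩

/-- Satisfaction in embedded structures is uniformly definable. -/
theorem exists_relativization {α β : Type} (φ : Fml α β) :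
    ∃ ψ : Fml α (β ⊕ Fin 3), ∀ (M N : ClassModel.{u}) (e : N.Obj → M.Obj) (E R U : M.classes)
      (h : M.Embeds N e E R U) (v : α → N.Obj) (V : β → N.classes),
      N.Sat φ v V ↔ M.Sat ψ (fun x => e (v x)) (Sum.elim (fun X => h.img (V X)) ![E, R, U]) := by
  induction φ with
  | eqO x y => exact ⟨.eqO x y, fun M N e E R U h v V => h.inj.eq_iff.symm⟩
  | memO x y =>
    obtain ⟨ψ, hψ⟩ := Dfn.exists_formula (𝓜 := fun N : ClassModel.{u} => N) (α := Fin 2)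
      (β := Unit) (R := fun N v V => N.PairInClass (V ()) (v 0) (v 1)) inferInstance
    refine ⟨ψ.rename ![x, y] (fun _ => .inr 0), fun M N e E R U h v V => ?_⟩
    rw [sat_rename, hψ]
    exact h.mem _ _
  | ur x => exact ⟨.memC x (.inr 2), fun M N e E R U h v V => h.ur _⟩
  | eqC X Y =>
    exact ⟨.eqC (.inl X) (.inl Y), fun M N e E R U h v V =>
      (Subtype.ext_iff.trans h.inj.image_injective.eq_iff.symm).trans
        (Subtype.ext_iff (a1 := h.img (V X)) (a2 := h.img (V Y))).symm⟩
  | memC x X =>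
    exact ⟨.memC x (.inl X), fun M N e E R U h v V => (h.inj.mem_set_image).symm⟩
  | neg φ ih =>
    obtain ⟨ψ, hψ⟩ := ih
    exact ⟨.neg ψ, fun M N e E R U h v V => not_congr (hψ ..)⟩
  | and φ φ' ih ih' =>
    obtain ⟨ψ, hψ⟩ := ih
    obtain ⟨ψ', hψ'⟩ := ih'
    exact ⟨.and ψ ψ', fun M N e E R U h v V => and_congr (hψ ..) (hψ' ..)⟩
  | exO φ ih =>
    obtain ⟨ψ, hψ⟩ := ih
    refine ⟨.exO (.and (.memC none (.inr 1)) ψ), fun M N e E R U h v V => ?_⟩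
    have key (a : N.Obj) : N.Sat φ (fun i => i.elim a v) V ↔ M.Sat ψ
        (fun i => i.elim (e a) (fun x => e (v x)))
        (Sum.elim (fun X => h.img (V X)) ![E, R, U]) := by
      rw [hψ M N e E R U h]
      refine iff_of_eq ?_
      congr 1
      funext i; cases i <;> rfl
    constructor
    · rintro ⟨a, ha⟩
      exact ⟨e a, (h.range _).2 ⟨a, rfl⟩, (key a).1 ha⟩
    · rintro ⟨x, hx, ha⟩
      obtain ⟨a, rfl⟩ := (h.range _).1 hx
      exact ⟨a, (key a).2 ha⟩
  | @exC α β φ ih =>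
    obtain ⟨ψ, hψ⟩ := ih
    obtain ⟨χ, hχ⟩ := Dfn.exists_formula (𝓜 := fun N : ClassModel.{u} => N) (α := α)
      (β := Option (β ⊕ Fin 3)) (R := fun N v V => ∀ x, x ∈ (V none : Set N.Obj) →
        x ∈ (V (some (.inr 1)) : Set N.Obj)) inferInstance
    -- The formula `χ` restricts the class quantifier to subclasses of `R`; these are exactly the
    -- images of classes of `N`.
    refine ⟨.exC (.and χ (ψ.rename id (Sum.elim (fun X => X.elim none (some ∘ .inl))
      (some ∘ .inr)))), fun M N e E R U h v V => ?_⟩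
    have key (A : N.classes) : N.Sat φ v (fun i => i.elim A V) ↔ M.Sat
        (ψ.rename id (Sum.elim (fun X => X.elim none (some ∘ .inl)) (some ∘ .inr)))
        (fun x => e (v x))
        (fun i => i.elim (h.img A) (Sum.elim (fun X => h.img (V X)) ![E, R, U])) := by
      rw [hψ M N e E R U h, sat_rename]
      refine iff_of_eq ?_
      congr 1
      funext i; rcases i with (_ | i) | i <;> rfl
    constructor
    · rintro ⟨A, hA⟩
      refine ⟨h.img A, (hχ ..).2 ?_, (key A).1 hA⟩
      rintro x ⟨a, -, rfl⟩
      exact (h.range _).2 ⟨a, rfl⟩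
    · rintro ⟨A, hAR, hA⟩
      have hAR := (hχ ..).1 hAR
      have hA' : e '' (e ⁻¹' A) = A := by
        refine Set.image_preimage_eq_of_subset fun x hx => ?_
        exact (h.range x).1 (hAR x hx)
      refine ⟨⟨e ⁻¹' A, (h.classes _).2 (by rw [hA']; exact A.2)⟩, (key _).2 ?_⟩
      convert hA using 3
      exact Subtype.ext hA'

/-- `e` embeds `N` into `M` as a class structure that is well-founded and in which exactly the
sets of `M` are coded. -/
structure Realizes (M N : ClassModel.{u}) (e : N.Obj → M.Obj) : Prop where
  embeds : ∃ E R U, M.Embeds N e E R U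
  exists_set : ∀ b, ∃ s, M.IsSet s ∧ ∀ x, M.mem x s ↔ ∃ a, N.mem a b ∧ e a = x
  exists_code : ∀ s, M.IsSet s → (∀ x, M.mem x s → ∃ a, e a = x) →
    ∃ b, N.IsSet b ∧ ∀ a, N.mem a b ↔ M.mem (e a) s
  ur_no_mem : ∀ x, N.ur x → ¬ ∃ y, N.mem y x
  ext : ∀ x y, N.IsSet x → N.IsSet y → (∀ z, N.mem z y ↔ N.mem z x) → x = y
  wf : ∀ Y ∈ N.classes, ∀ a ∈ Y, ∃ m ∈ Y, ∀ b, N.mem b m → b ∉ Y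

namespace Realizes

variable {M N : ClassModel.{u}} {e : N.Obj → M.Obj}

theorem inj (h : M.Realizes N e) : Function.Injective e := by
  obtain ⟨E, R, U, h⟩ := h.embeds
  exact h.inj

theorem classes (h : M.Realizes N e) (Y : Set N.Obj) : Y ∈ N.classes ↔ e '' Y ∈ M.classes := by
  obtain ⟨E, R, U, h⟩ := h.embeds
  exact h.classes Y

/-- The class of `M` that corresponds to a class of a realized structure. -/
def img (h : M.Realizes N e) (Y : N.classes) : M.classes := ⟨e '' Y, (h.classes _).1 Y.2⟩

theorem mem_img (h : M.Realizes N e) {Y : N.classes} {a : N.Obj} :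
    e a ∈ (h.img Y : Set M.Obj) ↔ a ∈ (Y : Set N.Obj) := h.inj.mem_set_image

theorem exists_class (h : M.Realizes N e) (hM : M.Core) (P : M.Obj → Prop) [M.DfnPred P] :
    ∃ C : N.classes, ∀ a, a ∈ (C : Set N.Obj) ↔ P (e a) := by
  obtain ⟨E, R, U, h⟩ := h.embeds
  obtain ⟨C, hC⟩ := hM.exists_class (fun x => P x ∧ x ∈ (R : Set M.Obj))
  refine ⟨⟨e ⁻¹' C, (h.classes _).2 ?_⟩, fun a => ?_⟩
  · rw [Set.image_preimage_eq_of_subset fun x hx => (h.range x).1 ((hC x).1 hx).2]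
    exact C.2
  · exact (hC _).trans (and_iff_left ((h.range _).2 ⟨a, rfl⟩))

/-- The set of images of the members of `x` is separated in `M` by the image of `Y`, and the result
is coded back in `N`. -/
theorem separation (h : M.Realizes N e) (hM : M.Core) (Y : N.classes) (x : N.Obj) :
    ∃ y, N.IsSet y ∧ ∀ z, N.mem z y ↔ z ∈ (Y : Set N.Obj) ∧ N.mem z x := by
  obtain ⟨s, hs, hsx⟩ := h.exists_set x
  obtain ⟨r, hr, hrs⟩ := hM.separation _ (h.img Y).2 s hs
  obtain ⟨y, hy, H⟩ := h.exists_code r hr (fun z hz => by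
    obtain ⟨a, -, ha⟩ := (hsx z).1 ((hrs z).1 hz).2
    exact ⟨a, ha⟩)
  refine ⟨y, hy, fun z => ?_⟩
  rw [H, hrs, h.mem_img, hsx]
  refine and_congr_right fun _ => ⟨fun ⟨a, ha, h'⟩ => h.inj h' ▸ ha, fun hz => ⟨z, hz, rfl⟩⟩

theorem comprehension (h : M.Realizes N e) (hM : M.Core) : N.FullComprehension := by
  obtain ⟨E, R, U, h'⟩ := h.embeds
  intro m n φ v V
  obtain ⟨ψ, hψ⟩ := exists_relativization φ
  have : M.DfnPred (fun x => M.Sat ψ (fun i => i.elim x (fun j => e (v j)))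
      (Sum.elim (fun X => h'.img (V X)) ![E, R, U])) :=
    ((Dfn.of_formula (k := True) (𝓜 := fun _ : Unit => M) ψ).subst
      (fun i _ w => i.elim (w ()) (fun j => e (v j)))
      (fun j _ _ => Sum.elim (fun X => h'.img (V X)) ![E, R, U] j)
      (by rintro (_ | j); exacts [TermO.var (), TermO.const _])
      (fun j => TermC.const _))
  obtain ⟨C, hC⟩ := h.exists_class hM (fun x => M.Sat ψ (fun i => i.elim x (fun j => e (v j)))
      (Sum.elim (fun X => h'.img (V X)) ![E, R, U]))
  convert C.2 using 1
  ext a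
  rw [hC, Set.mem_ofPred_eq, hψ M N e E R U h']
  refine iff_of_eq ?_
  congr 1
  funext i; cases i <;> rfl

theorem foundation (h : M.Realizes N e) (hM : M.Core) (x : N.Obj) (hx : ∃ y, N.mem y x) :
    ∃ z, N.mem z x ∧ ¬ ∃ w, N.mem w z ∧ N.mem w x := by
  obtain ⟨s, hs, hsx⟩ := h.exists_set x
  obtain ⟨C, hC⟩ := h.exists_class hM (fun y => M.mem y s)
  have hC' a : a ∈ (C : Set N.Obj) ↔ N.mem a x := by
    rw [hC, hsx]
    exact ⟨fun ⟨a, ha, h'⟩ => h.inj h' ▸ ha, fun hz => ⟨a, hz, rfl⟩⟩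
  obtain ⟨y, hy⟩ := hx
  obtain ⟨m, hm, hm'⟩ := h.wf C C.2 y ((hC' y).2 hy)
  exact ⟨m, (hC' m).1 hm, fun ⟨w, hw, hw'⟩ => hm' w hw ((hC' w).2 hw')⟩

/-- Reflection in `M` down to a transitive set that is closed under the extensions of the objects
of a realized structure yields reflection in that structure. -/
theorem rp2 (h : M.Realizes N e) (hM : M.Core) : N.RP2 := by
  obtain ⟨E, R, U, h'⟩ := h.embeds
  intro n φ X hφ
  obtain ⟨ψ, hψ⟩ := exists_relativization φ
  obtain ⟨S, hS⟩ := hM.exists_rel (fun b s => ∀ x, M.mem x s ↔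
    x ∈ (R : Set M.Obj) ∧ M.PairInClass E x b)
  obtain ⟨o, -⟩ := hM.exists_empty
  have hdef : Dfn False (fun N : ClassModel.{u} => N) (α := Fin 2) (β := (Fin n ⊕ Fin 3) ⊕ Unit)
      (fun N v V => N.Sat ψ Empty.elim (fun j => V (.inl j))) :=
    ((Dfn.of_formula (k := False) (𝓜 := fun N : ClassModel.{u} => N) ψ).rename Empty.elim
      Sum.inl).congr fun N v V => iff_of_eq (by congr 1; funext x; exact x.elim)
  obtain ⟨t, ht, -, -, hsat, hcl⟩ := hM.reflect (β := (Fin n ⊕ Fin 3) ⊕ Unit) (a := o) (b := o)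
    (V := Sum.elim (Sum.elim (fun i => h'.img (X i)) ![E, R, U]) (fun _ => S))
    (fun N _ _ V => N.Sat ψ Empty.elim (fun j => V (.inl j)) ∧
      ∀ x, x ∈ (V (.inl (.inr 1)) : Set N.Obj) → ∃ s, N.PairInClass (V (.inr ())) x s) (by
    refine ⟨?_, fun x hx => ?_⟩
    · refine (iff_of_eq ?_).1 ((hψ M N e E R U h' Empty.elim X).1 hφ)
      congr 1
      funext x; exact x.elim
    · obtain ⟨b, rfl⟩ := (h'.range x).1 hx
      obtain ⟨s, -, hs⟩ := h.exists_set b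
      refine ⟨s, (hS _ _).2 fun x => (hs x).trans ⟨?_, ?_⟩⟩
      · rintro ⟨a, ha, rfl⟩
        exact ⟨(h'.range _).2 ⟨a, rfl⟩, (h'.mem _ _).1 ha⟩
      · rintro ⟨hx, hxb⟩
        obtain ⟨a, rfl⟩ := (h'.range x).1 hx
        exact ⟨a, (h'.mem _ _).2 hxb, rfl⟩)
  -- The reflecting set of `N` is the code `c` of `R ∩ t`. It is transitive in `N` because the
  -- extension of each coded object in `t` is a member of `t`, hence a subset of `t`.
  obtain ⟨r, hr, hrt⟩ := hM.separation R R.2 t ht.trans.1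
  obtain ⟨c, hc, hct⟩ := h.exists_code r hr fun x hx => (h'.range x).1 ((hrt x).1 hx).1
  have hct a : N.mem a c ↔ M.mem (e a) t := by
    rw [hct, hrt]
    exact and_iff_right ((h'.range _).2 ⟨a, rfl⟩)
  have hctrans : N.IsTransSet c := by
    refine ⟨hc, fun x hx a ha => (hct a).2 ?_⟩
    obtain ⟨s, hs⟩ := hcl ⟨e x, (hct x).1 hx⟩ ((h'.range _).2 ⟨x, rfl⟩)
    have hs := (hS _ _).1 ((hM.below_pairInClass ht _ _ _).1 hs)
    exact ht.trans.mem s.2 ((hs _).2 ⟨(h'.range _).2 ⟨a, rfl⟩, (h'.mem _ _).1 ha⟩)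
  -- The restriction of `e` embeds `N.below c` into `M.below t`, with the traces of the same three
  -- classes. So the same translation `ψ` turns truth below `t` into truth below `c`.
  have h'' : (M.below t).Embeds (N.below c) (fun a => ⟨e a.1, (hct _).1 a.2⟩)
      (hM.trace t ht.trans E) (hM.trace t ht.trans R) (hM.trace t ht.trans U) := by
    refine ⟨fun a b hab => Subtype.ext (h.inj (congrArg Subtype.val hab)), fun x => ?_,
      fun a b => ?_, fun a => h'.ur _, fun Y => ⟨?_, ?_⟩⟩
    · refine (h'.range x.1).trans ⟨?_, ?_⟩
      · rintro ⟨a, ha⟩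
        exact ⟨⟨a, (hct a).2 (ha ▸ x.2)⟩, Subtype.ext ha⟩
      · rintro ⟨a, rfl⟩
        exact ⟨a.1, rfl⟩
    · exact (h'.mem _ _).trans (hM.below_pairInClass ht E ⟨_, _⟩ ⟨_, _⟩).symm
    · rintro ⟨y, hy, hyc, hY⟩
      obtain ⟨s, hs, hsy⟩ := h.exists_set y
      refine ⟨s, hs, fun z hz => ?_, fun x => ?_⟩
      · obtain ⟨a, ha, rfl⟩ := (hsy z).1 hz
        exact (hct a).1 (hyc a ha)
      · rw [hsy]
        constructor
        · rintro ⟨a, ha, rfl⟩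
          exact ⟨a.1, (hY a).1 ha, rfl⟩
        · rintro ⟨a, ha, hax⟩
          exact ⟨⟨a, hyc a ha⟩, (hY _).2 ha, Subtype.ext hax⟩
    · rintro ⟨s, hs, hst, hY⟩
      obtain ⟨y, hy, hys⟩ := h.exists_code s hs (fun x hx => by
        obtain ⟨a, -, ha⟩ := (hY ⟨x, hst x hx⟩).2 hx
        exact ⟨a.1, congrArg Subtype.val ha⟩)
      refine ⟨y, hy, fun a ha => (hct a).2 (hst _ ((hys a).1 ha)), fun a => ?_⟩
      rw [hys, ← hY ⟨e a.1, (hct _).1 a.2⟩]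
      refine ⟨fun ha => ⟨a, ha, rfl⟩, ?_⟩
      rintro ⟨b, hb, hba⟩
      exact (Subtype.ext (h.inj (congrArg Subtype.val hba)) : b = a) ▸ hb
  have hY (i) : {x : (N.below c).Obj | x.1 ∈ (X i : Set N.Obj)} ∈ (N.below c).classes := by
    obtain ⟨y, hy, H⟩ := h.separation hM (X i) c
    exact ⟨y, hy, fun z hz => ((H z).1 hz).2, fun x => ((H x.1).trans (and_iff_left x.2)).symm⟩
  refine ⟨c, hctrans, fun i => ⟨_, hY i⟩, fun i x => Iff.rfl, ?_⟩
  refine (hψ _ _ _ _ _ _ h'' _ _).2 ((iff_of_eq ?_).1 hsat)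
  congr 1
  · funext x; exact x.elim
  · funext j
    rcases j with i | j
    · refine Subtype.ext (Set.ext fun x => ⟨?_, ?_⟩)
      · rintro ⟨a, ha, hax⟩
        exact ⟨⟨a, (hct a).2 (hax ▸ x.2)⟩, ha, Subtype.ext hax⟩
      · rintro ⟨a, ha, rfl⟩
        exact ⟨a.1, ha, rfl⟩
    · fin_cases j <;> rfl

theorem core (h : M.Realizes N e) (hM : M.Core) : N.Core where
  ur_no_mem := h.ur_no_mem
  ext := h.ext
  foundation := h.foundation hM
  separation Y hY x _ := h.separation hM ⟨Y, hY⟩ x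
  comprehension := h.comprehension hM
  rp2 := h.rp2 hM

end Realizes
end ClassModel

/-! ### Inheritance of Limitation of Size and Choice by realized structures. -/

namespace ClassModel
namespace Realizes

variable {M N K : ClassModel.{u}} {e : N.Obj → M.Obj} {f : K.Obj → N.Obj}

/-- Relations that are definable in a realized structure are definable. -/
theorem dfn (h : M.Realizes N e) {α : Type} [Finite α] {R : (α → N.Obj) → Prop}
    (hR : Dfn True (fun _ : Unit => N) (α := α) (β := Empty) fun _ v _ => R v) :
    Dfn True (fun _ : Unit => M) (α := α) (β := Empty)
      fun _ w _ => ∃ v, (∀ i, e (v i) = w i) ∧ R v := by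
  obtain ⟨E, D, U, h⟩ := h.embeds
  obtain ⟨γ, δ, _, _, -, p, P, φ, hφ⟩ := hR
  obtain ⟨ψ, hψ⟩ := exists_relativization φ
  have h₁ : Dfn True (fun _ : Unit => M) (α := α) (β := Empty)
      fun _ w _ => ∀ i, w i ∈ (D : Set M.Obj) := Dfn.all_finite fun i => inferInstance
  have h₂ : Dfn True (fun _ : Unit => M) (α := α) (β := Empty)
      fun _ w _ => M.Sat ψ (Sum.elim w (fun i => e (p () i)))
        (Sum.elim (fun X => h.img (Sum.elim Empty.elim (P ()) X)) ![E, D, U]) :=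
    ((Dfn.of_formula (k := True) (𝓜 := fun _ : Unit => M) ψ).subst
      (fun i _ w => Sum.elim w (fun i => e (p () i)) i)
      (fun j _ _ => Sum.elim (fun X => h.img (Sum.elim Empty.elim (P ()) X)) ![E, D, U] j)
      (by rintro (i | i); exacts [TermO.var i, TermO.const _])
      (fun j => TermC.const _))
  refine Dfn.congr (R := fun _ w _ => (∀ i, w i ∈ (D : Set M.Obj)) ∧
    M.Sat ψ (Sum.elim w (fun i => e (p () i)))
      (Sum.elim (fun X => h.img (Sum.elim Empty.elim (P ()) X)) ![E, D, U])) inferInstance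
      fun _ w V => ?_
  have key (v : α → N.Obj) : R v ↔ M.Sat ψ (Sum.elim (fun i => e (v i)) (fun i => e (p () i)))
      (Sum.elim (fun X => h.img (Sum.elim Empty.elim (P ()) X)) ![E, D, U]) := by
    rw [← hφ () v Empty.elim, hψ M N e E D U h]
    refine iff_of_eq ?_
    congr 1
    funext i; cases i <;> rfl
  constructor
  · rintro ⟨hw, hs⟩
    choose v hv using fun i => (h.range _).1 (hw i)
    obtain rfl : (fun i => e (v i)) = w := funext hv
    exact ⟨v, fun _ => rfl, (key v).2 hs⟩
  · rintro ⟨v, hv, hR⟩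
    obtain rfl : (fun i => e (v i)) = w := funext hv
    exact ⟨fun i => (h.range _).2 ⟨_, rfl⟩, (key v).1 hR⟩

theorem exists_rel_img (h : M.Realizes N e) (hM : M.Core) (Q : N.Obj → N.Obj → Prop)
    [hQ : N.DfnRel Q] :
    ∃ F : M.classes, ∀ x y, M.PairInClass F x y ↔ ∃ a b, e a = x ∧ e b = y ∧ Q a b := by
  have : M.DfnRel (fun x y => ∃ a b, e a = x ∧ e b = y ∧ Q a b) :=
    (h.dfn hQ).congr fun _ w _ => ⟨fun ⟨v, hv, hq⟩ => ⟨v 0, v 1, hv 0, hv 1, hq⟩,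
      fun ⟨a, b, ha, hb, hq⟩ => ⟨![a, b], Fin.forall_fin_two.2 ⟨ha, hb⟩, hq⟩⟩
  exact hM.exists_rel _

/-- `N` may form ordered pairs differently from `M`. The class consists of the pairs in the sense of
`N`, a notion that `dfn` makes definable in `M`. -/
theorem exists_rel_comap (h : M.Realizes N e) (hM : M.Core) (Q : M.Obj → M.Obj → Prop)
    [hQ : M.DfnRel Q] :
    ∃ F : N.classes, ∀ a b, N.PairInClass F a b ↔ Q (e a) (e b) := by
  have h₁ : Dfn True (fun _ : Unit => M) (α := Option (Option Unit)) (β := Empty)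
      (fun _ v _ => Q (v (some none)) (v none)) := hQ.rename ![some none, none] id
  have h₂ : Dfn True (fun _ : Unit => N) (α := Fin 3) (β := Empty)
      (fun _ v _ => N.IsOPair (v 0) (v 1) (v 2)) := inferInstance
  have h₃ := (h.dfn h₂).rename (α' := Option (Option Unit)) (β' := Empty)
      ![some (some ()), some none, none] id
  have h₄ : M.DfnPred (fun x => ∃ y z, (∃ v : Fin 3 → N.Obj,
      (∀ i, e (v i) = ![x, y, z] i) ∧ N.IsOPair (v 0) (v 1) (v 2)) ∧ Q y z) := by
    have h₃ : Dfn True (fun _ : Unit => M) (α := Option (Option Unit)) (β := Empty)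
        (fun _ v _ => ∃ v' : Fin 3 → N.Obj, (∀ i, e (v' i) = ![v (some (some ())), v (some none),
          v none] i) ∧ N.IsOPair (v' 0) (v' 1) (v' 2)) := by
      refine h₃.congr fun _ w _ => exists_congr fun v => and_congr_left' (forall_congr' fun i => ?_)
      fin_cases i <;> rfl
    infer_instance
  obtain ⟨F, hF⟩ := h.exists_class hM (fun x => ∃ y z, (∃ v : Fin 3 → N.Obj,
      (∀ i, e (v i) = ![x, y, z] i) ∧ N.IsOPair (v 0) (v 1) (v 2)) ∧ Q y z)
  refine ⟨F, fun a b => ⟨?_, fun hab => ?_⟩⟩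
  · rintro ⟨z, hz, hp⟩
    obtain ⟨x, y, ⟨v, hv, hp'⟩, hq⟩ := (hF z).1 hz
    have h0 : v 0 = z := h.inj (hv 0)
    obtain ⟨h1, h2⟩ := Core.opair_inj (h0 ▸ hp') hp
    have hx : e (v 1) = x := hv 1
    have hy : e (v 2) = y := hv 2
    rwa [← h1, ← h2, hx, hy]
  · obtain ⟨z, hz⟩ := (h.core hM).exists_opair a b
    exact ⟨z, (hF z).2 ⟨e a, e b, ⟨![z, a, b], fun i => by fin_cases i <;> rfl, hz⟩, hab⟩, hz⟩

/-- Composition makes the pure part of V⟦W⟧, and the urelement extension of a pure part, comparable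
with the original model inside that model. -/
theorem trans (h : M.Realizes N e) (hM : M.Core) (h' : N.Realizes K f) :
    M.Realizes K (e ∘ f) where
  embeds := by
    obtain ⟨E, R, U, H⟩ := h'.embeds
    obtain ⟨F, hF⟩ := h.exists_rel_img hM (fun a b => N.PairInClass E a b)
    refine ⟨F, h.img R, h.img U, h.inj.comp h'.inj, fun x => ?_, fun a b => ?_, fun a => ?_,
      fun Y => ?_⟩
    · constructor
      · rintro ⟨a, ha, rfl⟩
        obtain ⟨b, rfl⟩ := (H.range _).1 ha
        exact ⟨b, rfl⟩
      · rintro ⟨b, rfl⟩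
        exact ⟨f b, (H.range _).2 ⟨b, rfl⟩, rfl⟩
    · rw [H.mem, hF]
      exact ⟨fun hab => ⟨_, _, rfl, rfl, hab⟩,
        fun ⟨a', b', ha, hb, hab⟩ => h.inj ha ▸ h.inj hb ▸ hab⟩
    · exact (H.ur a).trans h.mem_img.symm
    · rw [H.classes, h.classes, Set.image_comp]
  exists_set b := by
    obtain ⟨s, hs, hsb⟩ := h'.exists_set b
    obtain ⟨r, hr, hrs⟩ := h.exists_set s
    refine ⟨r, hr, fun x => (hrs x).trans ⟨?_, ?_⟩⟩
    · rintro ⟨a, ha, rfl⟩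
      obtain ⟨c, hc, rfl⟩ := (hsb a).1 ha
      exact ⟨c, hc, rfl⟩
    · rintro ⟨c, hc, rfl⟩
      exact ⟨f c, (hsb _).2 ⟨c, hc, rfl⟩, rfl⟩
  exists_code s hs hse := by
    obtain ⟨b, hb, hbs⟩ := h.exists_code s hs fun x hx => (hse x hx).imp' f fun _ h => h
    obtain ⟨c, hc, hcb⟩ := h'.exists_code b hb fun x hx => by
      obtain ⟨a, ha⟩ := hse _ ((hbs x).1 hx)
      exact ⟨a, h.inj ha⟩
    exact ⟨c, hc, fun a => (hcb a).trans (hbs _)⟩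
  ur_no_mem := h'.ur_no_mem
  ext := h'.ext
  wf := h'.wf

theorem isProper_img (h : M.Realizes N e) {X : N.classes} (hX : N.IsProper X) :
    M.IsProper (h.img X) := by
  rintro ⟨s, hs, hsX⟩
  obtain ⟨b, hb, hbs⟩ := h.exists_code s hs fun x hx => by
    obtain ⟨a, -, ha⟩ := (hsX x).1 hx
    exact ⟨a, ha⟩
  exact hX ⟨b, hb, fun z => by rw [hbs, hsX, h.mem_img]⟩

theorem limitationOfSize (h : M.Realizes N e) (hM : M.Core) (hL : M.LimitationOfSize) :
    N.LimitationOfSize := by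
  intro X hX Y hY hpX hpY
  lift X to N.classes using hX
  lift Y to N.classes using hY
  obtain ⟨F, hF, h₁, h₂⟩ := hL _ (h.img X).2 _ (h.img Y).2 (h.isProper_img hpX) (h.isProper_img hpY)
  lift F to M.classes using hF
  obtain ⟨G, hG⟩ := h.exists_rel_comap hM (fun x y => M.PairInClass F x y)
  refine ⟨G, G.2, fun x hx => ?_, fun y hy => ?_⟩
  · obtain ⟨_, ⟨⟨y, hy, rfl⟩, hxy⟩, hu⟩ := h₁ _ (h.mem_img.2 hx)
    exact ⟨y, ⟨hy, (hG _ _).2 hxy⟩,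
      fun z hz => h.inj (hu _ ⟨h.mem_img.2 hz.1, (hG _ _).1 hz.2⟩)⟩
  · obtain ⟨_, ⟨⟨x, hx, rfl⟩, hxy⟩, hu⟩ := h₂ _ (h.mem_img.2 hy)
    exact ⟨x, ⟨hx, (hG _ _).2 hxy⟩,
      fun z hz => h.inj (hu _ ⟨h.mem_img.2 hz.1, (hG _ _).1 hz.2⟩)⟩

/-- A well-order in `M` of the extension of `x` pulls back to a class of pairs of `N`. A set `t` of
`N` that contains `x` and is closed under pairs cuts this class down to a set without losing pairs
of members of `x`. -/
theorem ac (h : M.Realizes N e) (hM : M.Core) (hAC : M.AC) : N.AC := by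
  intro x hx
  have hN := h.core hM
  obtain ⟨s, hs, hsx⟩ := h.exists_set x
  have hsx' a : M.mem (e a) s ↔ N.mem a x := by
    rw [hsx]
    exact ⟨fun ⟨b, hb, hab⟩ => h.inj hab ▸ hb, fun ha => ⟨a, ha, rfl⟩⟩
  obtain ⟨r, hr, irrefl, trans, total, least⟩ := hAC s hs
  obtain ⟨C, hC⟩ := h.exists_rel_comap hM (fun x y => M.PairInSet r x y)
  obtain ⟨t, ht, hxt⟩ := hN.exists_nice x
  obtain ⟨q, hq, hqC⟩ := hN.separation C C.2 t ht.trans.1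
  have key a b (ha : N.mem a x) (hb : N.mem b x) :
      N.PairInSet q a b ↔ M.PairInSet r (e a) (e b) := by
    rw [← hC]
    constructor
    · rintro ⟨z, hz, hp⟩
      exact ⟨z, ((hqC z).1 hz).1, hp⟩
    · rintro ⟨z, hz, hp⟩
      exact ⟨z, (hqC z).2 ⟨hz, hN.opair_mem ht (ht.trans.mem hxt ha) (ht.trans.mem hxt hb) hp⟩, hp⟩
  refine ⟨q, hq, fun a ha hq => ?_, fun a b c ha hb hc h₁ h₂ => ?_, fun a b ha hb => ?_,
    fun p hp hpx hne => ?_⟩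
  · exact irrefl _ ((hsx' a).2 ha) ((key _ _ ha ha).1 hq)
  · rw [key _ _ ‹_› ‹_›] at *
    exact trans _ _ _ ((hsx' a).2 ha) ((hsx' b).2 hb) ((hsx' c).2 hc) h₁ h₂
  · rw [key _ _ ha hb, key _ _ hb ha, ← h.inj.eq_iff]
    exact total _ _ ((hsx' a).2 ha) ((hsx' b).2 hb)
  · obtain ⟨p', hp', hpp'⟩ := h.exists_set p
    obtain ⟨a, ha⟩ := hne
    obtain ⟨m, hm, hmin⟩ := least p' hp' (fun z hz => by
      obtain ⟨b, hb, rfl⟩ := (hpp' z).1 hz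
      exact (hsx' b).2 (hpx b hb)) ⟨e a, (hpp' _).2 ⟨a, ha, rfl⟩⟩
    obtain ⟨n, hn, rfl⟩ := (hpp' m).1 hm
    refine ⟨n, hn, fun b hb => ?_⟩
    rw [key _ _ (hpx n hn) (hpx b hb), ← h.inj.eq_iff]
    exact hmin _ ((hpp' _).2 ⟨b, hb, rfl⟩)

/-- A realized structure inherits `KMU`. -/
theorem isKMU (h : M.Realizes N e) (hM : M.Core) (hAC : M.AC) : N.IsKMU :=
  (h.core hM).isKMU (h.ac hM hAC)

end Realizes
end ClassModel

/-! ### Isomorphisms between realized structures. -/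

namespace ClassModel
namespace Realizes

variable {M N₁ N₂ : ClassModel.{u}} {e₁ : N₁.Obj → M.Obj} {e₂ : N₂.Obj → M.Obj}

theorem induct (h : M.Realizes N₁ e₁) (hM : M.Core) (P : N₁.Obj → Prop) (Q : M.Obj → Prop)
    [M.DfnPred Q] (hPQ : ∀ a, P a ↔ Q (e₁ a)) (ih : ∀ a, (∀ b, N₁.mem b a → P b) → P a)
    (a : N₁.Obj) : P a := by
  by_contra ha
  obtain ⟨C, hC⟩ := h.exists_class hM (fun x => ¬ Q x)
  obtain ⟨m, hm, hmin⟩ := h.wf C C.2 a ((hC a).2 fun hq => ha ((hPQ a).2 hq))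
  refine (hC m).1 hm ((hPQ m).1 (ih m fun b hb => ?_))
  by_contra hb'
  exact hmin b hb ((hC b).2 fun hq => hb' ((hPQ b).2 hq))

/-- `k` matches sets of `N₁` with sets of `N₂` whose members match, and urelements according to
`g`. -/
def IsMatching (N₁ N₂ : ClassModel.{u}) (g k : N₁.Obj → N₂.Obj → Prop) : Prop :=
  ∀ a b, k a b ↔ (N₁.ur a ∧ N₂.ur b ∧ g a b) ∨ (N₁.IsSet a ∧ N₂.IsSet b ∧
    (∀ a', N₁.mem a' a → ∃ b', N₂.mem b' b ∧ k a' b') ∧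
    (∀ b', N₂.mem b' b → ∃ a', N₁.mem a' a ∧ k a' b'))

theorem IsMatching.flip {g k : N₁.Obj → N₂.Obj → Prop} (hk : IsMatching N₁ N₂ g k) :
    IsMatching N₂ N₁ (fun b a => g a b) (fun b a => k a b) := fun b a => by
  refine (hk a b).trans ?_
  tauto

/-- By ∈-induction: for a set `a`, the partners of its members form a set by Replacement, and the
code of that set in `N₂` is the partner of `a`; Extensionality makes it unique. Urelements are
settled by `hg`. -/
theorem IsMatching.existsUnique {g k : N₁.Obj → N₂.Obj → Prop} (hk : IsMatching N₁ N₂ g k)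
    (hM : M.Core) (h₁ : M.Realizes N₁ e₁) (h₂ : M.Realizes N₂ e₂) (H : M.classes)
    (hH : ∀ a b, M.PairInClass H (e₁ a) (e₂ b) ↔ k a b)
    (hg : ∀ a, N₁.ur a → ∃! b, N₂.ur b ∧ g a b) (a : N₁.Obj) : ∃! b, k a b := by
  obtain ⟨E, D, U, h'⟩ := h₂.embeds
  -- The induction hypothesis is expressed in `M`, so that the exceptions to it form a class.
  have hQ a : (∃! b, k a b) ↔ ∃! y, y ∈ (D : Set M.Obj) ∧ M.PairInClass H (e₁ a) y := by
    constructor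
    · rintro ⟨b, hb, hu⟩
      refine ⟨e₂ b, ⟨(h'.range _).2 ⟨b, rfl⟩, (hH _ _).2 hb⟩, ?_⟩
      rintro y ⟨hy, hy'⟩
      obtain ⟨c, rfl⟩ := (h'.range _).1 hy
      rw [hu c ((hH _ _).1 hy')]
    · rintro ⟨y, ⟨hy, hy'⟩, hu⟩
      obtain ⟨b, rfl⟩ := (h'.range _).1 hy
      exact ⟨b, (hH _ _).1 hy', fun c hc =>
        h'.inj (hu _ ⟨(h'.range _).2 ⟨c, rfl⟩, (hH _ _).2 hc⟩)⟩
  refine h₁.induct hM (fun a => ∃! b, k a b)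
    (fun x => ∃! y, y ∈ (D : Set M.Obj) ∧ M.PairInClass H x y) hQ (fun a ih => ?_) a
  by_cases ha : N₁.ur a
  · refine (existsUnique_congr fun b => ?_).1 (hg a ha)
    rw [hk]
    exact ⟨fun h => .inl ⟨ha, h⟩, fun h => h.elim And.right fun h => absurd ha h.1⟩
  obtain ⟨s, hs, hsa⟩ := h₁.exists_set a
  obtain ⟨z, hz, hzs⟩ := hM.exists_image
    (fun x y => y ∈ (D : Set M.Obj) ∧ M.PairInClass H x y) s fun x hx => by
      obtain ⟨a', ha', rfl⟩ := (hsa x).1 hx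
      exact (hQ a').1 (ih a' ha')
  obtain ⟨c, hc, hcz⟩ := h₂.exists_code z hz fun y hy => by
    obtain ⟨x, -, hD, -⟩ := (hzs y).1 hy
    exact (h'.range _).1 hD
  have hc' b : N₂.mem b c ↔ ∃ a', N₁.mem a' a ∧ k a' b := by
    rw [hcz, hzs]
    constructor
    · rintro ⟨x, hx, -, hxb⟩
      obtain ⟨a', ha', rfl⟩ := (hsa x).1 hx
      exact ⟨a', ha', (hH _ _).1 hxb⟩
    · rintro ⟨a', ha', h⟩
      exact ⟨e₁ a', (hsa _).2 ⟨a', ha', rfl⟩, (h'.range _).2 ⟨b, rfl⟩, (hH _ _).2 h⟩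
  refine ⟨c, (hk a c).2 (.inr ⟨ha, hc, fun a' ha' => ?_, fun b' hb' => (hc' b').1 hb'⟩),
    fun b hb => ?_⟩
  · obtain ⟨b', hb', -⟩ := ih a' ha'
    exact ⟨b', (hc' b').2 ⟨a', ha', hb'⟩, hb'⟩
  · rcases (hk a b).1 hb with h | ⟨-, hb, h, h'⟩
    · exact absurd h.1 ha
    · refine h₂.ext b c hb hc fun b' => (hc' b').trans ⟨?_, h' b'⟩
      rintro ⟨a', ha', hab'⟩
      obtain ⟨b'', hb'', hab''⟩ := h a' ha'
      rwa [(ih a' ha').unique hab' hab'']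

/-- `f` is an isomorphism of class structures. -/
structure _root_.ClassModel.IsIso (N₁ N₂ : ClassModel.{u}) (f : N₁.Obj ≃ N₂.Obj) : Prop where
  mem : ∀ a b, N₁.mem a b ↔ N₂.mem (f a) (f b)
  ur : ∀ a, N₁.ur a ↔ N₂.ur (f a)
  classes : ∀ Y, Y ∈ N₁.classes ↔ f '' Y ∈ N₂.classes

theorem _root_.ClassModel.IsIso.classes_symm {f : N₁.Obj ≃ N₂.Obj} (hf : IsIso N₁ N₂ f)
    (Y : Set N₂.Obj) : Y ∈ N₂.classes ↔ f.symm '' Y ∈ N₁.classes := by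
  rw [hf.classes, Equiv.image_symm_image]

/-- Two structures that are realized in `M` are isomorphic by a class of `M` if their urelements
are in bijection by a class of `M`. -/
theorem exists_iso (hM : M.Core) (h₁ : M.Realizes N₁ e₁) (h₂ : M.Realizes N₂ e₂) (G : M.classes)
    (hG₁ : ∀ a, N₁.ur a → ∃! b, N₂.ur b ∧ M.PairInClass G (e₁ a) (e₂ b))
    (hG₂ : ∀ b, N₂.ur b → ∃! a, N₁.ur a ∧ M.PairInClass G (e₁ a) (e₂ b)) :
    ∃ (H : M.classes) (f : N₁.Obj ≃ N₂.Obj), IsIso N₁ N₂ f ∧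
      ∀ x y, M.PairInClass H x y ↔ ∃ a, x = e₁ a ∧ y = e₂ (f a) := by
  obtain ⟨E₁, D₁, U₁, h₁'⟩ := h₁.embeds
  obtain ⟨E₂, D₂, U₂, h₂'⟩ := h₂.embeds
  -- The matching clauses of `IsMatching`, written for codes in `M`, are monotone in `K`.
  obtain ⟨H, hH⟩ := hM.exists_fixRel (fun K x y =>
    (x ∈ (U₁ : Set M.Obj) ∧ y ∈ (U₂ : Set M.Obj) ∧ M.PairInClass G x y) ∨
    (¬ x ∈ (U₁ : Set M.Obj) ∧ ¬ y ∈ (U₂ : Set M.Obj) ∧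
      (∀ x', x' ∈ (D₁ : Set M.Obj) → M.PairInClass E₁ x' x →
        ∃ y', y' ∈ (D₂ : Set M.Obj) ∧ M.PairInClass E₂ y' y ∧ K x' y') ∧
      (∀ y', y' ∈ (D₂ : Set M.Obj) → M.PairInClass E₂ y' y →
        ∃ x', x' ∈ (D₁ : Set M.Obj) ∧ M.PairInClass E₁ x' x ∧ K x' y'))) (by
    rintro K K' hK x y (h | ⟨h, h', h₁, h₂⟩)
    · exact .inl h
    · exact .inr ⟨h, h',
        fun x' hx hx' => (h₁ x' hx hx').imp fun y' h => ⟨h.1, h.2.1, hK _ _ h.2.2⟩,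
        fun y' hy hy' => (h₂ y' hy hy').imp fun x' h => ⟨h.1, h.2.1, hK _ _ h.2.2⟩⟩)
  let k (a : N₁.Obj) (b : N₂.Obj) : Prop := M.PairInClass H (e₁ a) (e₂ b)
  have hk : IsMatching N₁ N₂ (fun a b => M.PairInClass G (e₁ a) (e₂ b)) k := fun a b => by
    refine (hH _ _).trans (or_congr ?_ ?_)
    · rw [h₁'.ur, h₂'.ur]
    · unfold IsSet
      rw [h₁'.ur, h₂'.ur]
      refine and_congr Iff.rfl (and_congr Iff.rfl (and_congr ⟨?_, ?_⟩ ⟨?_, ?_⟩))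
      · intro h a' ha'
        obtain ⟨y, hy, hyb, hK⟩ := h (e₁ a') ((h₁'.range _).2 ⟨_, rfl⟩) ((h₁'.mem _ _).1 ha')
        obtain ⟨b', rfl⟩ := (h₂'.range _).1 hy
        exact ⟨b', (h₂'.mem _ _).2 hyb, hK⟩
      · intro h x hx hxa
        obtain ⟨a', rfl⟩ := (h₁'.range _).1 hx
        obtain ⟨b', hb', hK⟩ := h a' ((h₁'.mem _ _).2 hxa)
        exact ⟨e₂ b', (h₂'.range _).2 ⟨_, rfl⟩, (h₂'.mem _ _).1 hb', hK⟩
      · intro h b' hb'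
        obtain ⟨x, hx, hxa, hK⟩ := h (e₂ b') ((h₂'.range _).2 ⟨_, rfl⟩) ((h₂'.mem _ _).1 hb')
        obtain ⟨a', rfl⟩ := (h₁'.range _).1 hx
        exact ⟨a', (h₁'.mem _ _).2 hxa, hK⟩
      · intro h y hy hyb
        obtain ⟨b', rfl⟩ := (h₂'.range _).1 hy
        obtain ⟨a', ha', hK⟩ := h b' ((h₂'.mem _ _).2 hyb)
        exact ⟨e₁ a', (h₁'.range _).2 ⟨_, rfl⟩, (h₁'.mem _ _).1 ha', hK⟩
  obtain ⟨H', hH'⟩ := hM.exists_rel (fun y x => M.PairInClass H x y)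
  choose f hf hfu using hk.existsUnique hM h₁ h₂ H (fun a b => Iff.rfl) hG₁
  choose f' hf' hfu' using hk.flip.existsUnique hM h₂ h₁ H' (fun b a => hH' _ _) hG₂
  let F : N₁.Obj ≃ N₂.Obj :=
    ⟨f, f', fun a => (hfu' _ _ (hf a)).symm, fun b => (hfu _ _ (hf' b)).symm⟩
  -- The fixed point may also relate objects that are not codes, so it is cut down to `D₁` and `D₂`.
  obtain ⟨I, hI⟩ := hM.exists_rel
    (fun x y => x ∈ (D₁ : Set M.Obj) ∧ y ∈ (D₂ : Set M.Obj) ∧ M.PairInClass H x y)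
  have hIF x y : M.PairInClass I x y ↔ ∃ a, x = e₁ a ∧ y = e₂ (F a) := by
    rw [hI]
    constructor
    · rintro ⟨hx, hy, h⟩
      obtain ⟨a, rfl⟩ := (h₁'.range _).1 hx
      obtain ⟨b, rfl⟩ := (h₂'.range _).1 hy
      exact ⟨a, rfl, by rw [hfu a b h]; rfl⟩
    · rintro ⟨a, rfl, rfl⟩
      exact ⟨(h₁'.range _).2 ⟨a, rfl⟩, (h₂'.range _).2 ⟨_, rfl⟩, hf a⟩
  refine ⟨I, F, ⟨fun a b => ⟨fun hab => ?_, fun hab => ?_⟩, fun a => ⟨fun ha => ?_, fun ha => ?_⟩,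
    fun Y => ⟨fun hY => ?_, fun hY => ?_⟩⟩, hIF⟩
  · rcases (hk _ _).1 (hf b) with h | ⟨-, -, h, -⟩
    · exact absurd ⟨a, hab⟩ (h₁.ur_no_mem b h.1)
    · obtain ⟨c, hc, hac⟩ := h a hab
      rw [hfu _ _ hac] at hc
      exact hc
  · rcases (hk _ _).1 (hf b) with h | ⟨-, -, -, h⟩
    · exact absurd ⟨_, hab⟩ (h₂.ur_no_mem _ h.2.1)
    · obtain ⟨c, hc, hca⟩ := h _ hab
      rwa [hfu' (f a) _ (hf a), ← hfu' (f a) _ hca]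
  · rcases (hk _ _).1 (hf a) with h | h
    exacts [h.2.1, absurd ha h.1]
  · rcases (hk _ _).1 (hf a) with h | h
    exacts [h.1, absurd ha h.2.1]
  · obtain ⟨C, hC⟩ := h₂.exists_class hM
      (fun y => ∃ x, x ∈ (h₁.img ⟨Y, hY⟩ : Set M.Obj) ∧ M.PairInClass I x y)
    convert C.2 using 1
    ext b
    rw [hC]
    constructor
    · rintro ⟨a, ha, rfl⟩
      exact ⟨e₁ a, ⟨a, ha, rfl⟩, (hIF _ _).2 ⟨a, rfl, rfl⟩⟩
    · rintro ⟨_, ⟨a, ha, rfl⟩, hab⟩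
      obtain ⟨a', h, h'⟩ := (hIF _ _).1 hab
      exact ⟨a, ha, by rw [h₁.inj h, h₂.inj h']⟩
  · obtain ⟨C, hC⟩ := h₁.exists_class hM
      (fun x => ∃ y, y ∈ (h₂.img ⟨_, hY⟩ : Set M.Obj) ∧ M.PairInClass I x y)
    convert C.2 using 1
    ext a
    rw [hC]
    constructor
    · intro ha
      exact ⟨e₂ (F a), ⟨_, ⟨a, ha, rfl⟩, rfl⟩, (hIF _ _).2 ⟨a, rfl, rfl⟩⟩
    · rintro ⟨_, ⟨_, ⟨a', ha', rfl⟩, rfl⟩, hab⟩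
      obtain ⟨a'', h, h'⟩ := (hIF _ _).1 hab
      rwa [h₁.inj h, ← F.injective (h₂.inj h')]

end Realizes
end ClassModel

/-! ### The pure part and V⟦W⟧ are realized. -/

namespace ClassModel
namespace Core

variable {M : ClassModel.{u}} (hM : M.Core)
include hM

theorem mem_irrefl (x : M.Obj) : ¬ M.mem x x := by
  refine hM.induct (fun x => ¬ M.mem x x) (fun x ih h => ih x h h) x

/-- Every core structure realizes itself. -/
theorem realizes_id : M.Realizes M id where
  embeds := by
    obtain ⟨E, hE⟩ := hM.exists_rel (fun x y => M.mem x y)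
    obtain ⟨R, hR⟩ := hM.exists_class (fun x => x = x)
    obtain ⟨U, hU⟩ := hM.exists_class (fun x => M.ur x)
    exact ⟨E, R, U, Function.injective_id, fun x => (hR x).trans (by simp),
      fun a b => (hE a b).symm, fun a => (hU a).symm, fun Y => by rw [Set.image_id]⟩
  exists_set b := by
    by_cases hb : M.IsSet b
    · exact ⟨b, hb, fun x => by simp⟩
    · obtain ⟨e, he, h⟩ := hM.exists_empty
      exact ⟨e, he, fun x => iff_of_false (h x) fun ⟨a, ha, _⟩ => hb (hM.isSet_of_mem ha)⟩
  exists_code s hs _ := ⟨s, hs, fun _ => Iff.rfl⟩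
  ur_no_mem := hM.ur_no_mem
  ext := hM.ext
  wf Y hY a ha := hM.wf ⟨Y, hY⟩ ha

omit hM in
theorem _root_.ClassModel.IsPure.isSet {x : M.Obj} (h : M.IsPure x) : M.IsSet x :=
  fun hx => h x hx fun _ _ ht => ht

omit hM in
theorem _root_.ClassModel.IsPure.mem {x y : M.Obj} (h : M.IsPure x) (hy : M.mem y x) :
    M.IsPure y :=
  fun a ha ht => h a ha fun t htr hx => ht t htr (htr.mem hx hy)

/-- A set of pure sets is pure. -/
theorem isPure_of_mem {x : M.Obj} (hx : M.IsSet x) (h : ∀ y, M.mem y x → M.IsPure y) :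
    M.IsPure x := by
  intro a ha hax
  obtain ⟨t, ht, hxt, -⟩ := hM.exists_trans x x
  -- The pure members of `t` together with `x` form a transitive set without urelements, which
  -- contains the transitive closure of {x}.
  obtain ⟨r, hr, hrt⟩ := hM.exists_sep ht.1 (fun y => M.mem y t ∧ (M.IsPure y ∨ y = x))
    fun z hz => hz.1
  have := hax r ⟨hr, fun y hy z hz => ?_⟩ ((hrt x).2 ⟨hxt, .inr rfl⟩)
  · rcases ((hrt a).1 this).2 with h | rfl
    exacts [h.isSet ha, hx ha]
  · obtain ⟨hyt, hy⟩ := (hrt y).1 hy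
    refine (hrt z).2 ⟨ht.mem hyt hz, .inl ?_⟩
    rcases hy with hy | rfl
    exacts [hy.mem hz, h z hz]

theorem realizes_purePart : M.Realizes M.purePart Subtype.val where
  embeds := by
    obtain ⟨E, hE⟩ := hM.exists_rel (fun x y => M.mem x y)
    obtain ⟨R, hR⟩ := hM.exists_class (fun x => M.IsPure x)
    obtain ⟨U, hU⟩ := hM.exists_class (fun x => M.ur x)
    exact ⟨E, R, U, Subtype.val_injective,
      fun x => (hR x).trans ⟨fun h => ⟨⟨x, h⟩, rfl⟩, fun ⟨a, ha⟩ => ha ▸ a.2⟩,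
      fun a b => (hE _ _).symm, fun a => (hU _).symm, fun Y => Iff.rfl⟩
  exists_set b := ⟨b.1, b.2.isSet, fun x =>
    ⟨fun hx => ⟨⟨x, b.2.mem hx⟩, hx, rfl⟩, fun ⟨a, ha, h⟩ => h ▸ ha⟩⟩
  exists_code s hs h := ⟨⟨s, hM.isPure_of_mem hs fun y hy => by
    obtain ⟨a, rfl⟩ := h y hy
    exact a.2⟩, hs, fun _ => Iff.rfl⟩
  ur_no_mem x hx := absurd hx x.2.isSet
  ext x y hx hy h := Subtype.ext (hM.ext _ _ hx hy fun z =>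
    ⟨fun hz => (h ⟨z, y.2.mem hz⟩).1 hz, fun hz => (h ⟨z, x.2.mem hz⟩).2 hz⟩)
  wf Y hY a ha := by
    obtain ⟨m, ⟨b, hb, rfl⟩, hmin⟩ := hM.wf ⟨_, hY⟩ (Set.mem_image_of_mem _ ha)
    exact ⟨b, hb, fun c hc hcY => hmin c.1 hc (Set.mem_image_of_mem _ hcY)⟩

omit hM in
theorem purePart_no_ur (x : M.purePart.Obj) : ¬ M.purePart.ur x := x.2.isSet

/-- The class of pure sets is proper. -/
theorem isProper_pure {P : Set M.Obj} (hP : ∀ x, M.IsPure x → x ∈ P) : M.IsProper P := by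
  rintro ⟨s, hs, hsP⟩
  -- A set of all pure sets would be pure, hence a member of itself.
  obtain ⟨r, hr, hrs⟩ := hM.exists_sep hs (fun x => M.IsPure x) fun z hz => (hsP z).2 (hP z hz)
  exact hM.mem_irrefl r ((hrs r).2 (hM.isPure_of_mem hr fun y hy => (hrs y).1 hy))

/-- A class is empty if each member is a pair whose second entry contains a member. -/
theorem not_mem_of_descending (Y : M.classes)
    (hY : ∀ y, y ∈ (Y : Set M.Obj) → ∃ o z, M.IsOPair y o z ∧ ∃ w, M.mem w z ∧ w ∈ (Y : Set M.Obj))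
    (y : M.Obj) : y ∉ (Y : Set M.Obj) := by
  intro hy
  -- A pair `y = ⟨o, z⟩` is joined to `w` by `w ∈ z ∈ {o, z} ∈ y`. Adding these intermediate levels
  -- to `Y` gives a class without ∈-minimal member.
  obtain ⟨T, hT⟩ := hM.exists_class (fun x => x ∈ (Y : Set M.Obj) ∨
    (∃ w, M.mem w x ∧ w ∈ (Y : Set M.Obj)) ∨
    ∃ z, M.mem z x ∧ ∃ w, M.mem w z ∧ w ∈ (Y : Set M.Obj))
  obtain ⟨m, hm, hmin⟩ := hM.wf T ((hT y).2 (.inl hy))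
  rcases (hT m).1 hm with hm | ⟨w, hw, hwY⟩ | ⟨z, hz, hw⟩
  · obtain ⟨o, z, ⟨s, d, h₁, h₂, h₃⟩, hw⟩ := hY m hm
    exact hmin d ((h₃.2 d).2 (.inr rfl)) ((hT d).2 (.inr (.inr ⟨z, (h₂.2 z).2 (.inr rfl), hw⟩)))
  · exact hmin w hw ((hT w).2 (.inl hwY))
  · exact hmin z hz ((hT z).2 (.inr (.inl hw)))

theorem exists_one : ∃ o, M.IsOne o := by
  obtain ⟨e, he⟩ := hM.exists_empty
  obtain ⟨o, ho⟩ := hM.exists_upair e e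
  exact ⟨o, e, he, ho⟩

omit hM in
theorem not_isEmptySet_of_isOne {o : M.Obj} (h : M.IsOne o) : ¬ M.IsEmptySet o := by
  obtain ⟨e, -, h⟩ := h
  exact fun h' => h'.2 e ((h.2 e).2 (.inl rfl))

theorem isEmptySet_unique {e e' : M.Obj} (h : M.IsEmptySet e) (h' : M.IsEmptySet e') : e = e' :=
  hM.ext _ _ h.1 h'.1 fun z => iff_of_false (h'.2 z) (h.2 z)

theorem isOne_unique {o o' : M.Obj} (h : M.IsOne o) (h' : M.IsOne o') : o = o' := by
  obtain ⟨e, he, h⟩ := h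
  obtain ⟨e', he', h'⟩ := h'
  obtain rfl := hM.isEmptySet_unique he he'
  exact hM.upair_unique h h'

/-- The recursion is monotone in `D`, so a solution exists. If `D` and `D'` are solutions, a member
of `D \ D'` must be some ⟨1, x⟩ where `x` has a member in `D \ D'`; this descent is impossible. -/
theorem existsUnique_isUrDomain (W : M.classes) : ∃! D, M.IsUrDomain W D := by
  obtain ⟨D, hD⟩ := hM.exists_fix (fun D y =>
    (∃ e a, M.IsEmptySet e ∧ a ∈ (W : Set M.Obj) ∧ M.IsOPair y e a) ∨
    (∃ o x, M.IsOne o ∧ M.IsSet x ∧ M.IsOPair y o x ∧ ∀ w, M.mem w x → w ∈ D)) (by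
      rintro K K' hK y (h | ⟨o, x, h₁, h₂, h₃, h⟩)
      exacts [.inl h, .inr ⟨o, x, h₁, h₂, h₃, fun w hw => hK (h w hw)⟩])
  refine ⟨D, ⟨D.2, hD⟩, ?_⟩
  have aux (D D' : M.classes) (hD : M.IsUrDomain W D) (hD' : M.IsUrDomain W D') :
      (D : Set M.Obj) ⊆ D' := by
    obtain ⟨Y, hY⟩ := hM.exists_class (fun x => x ∈ (D : Set M.Obj) ∧ ¬ x ∈ (D' : Set M.Obj))
    intro x hx
    by_contra hx'
    refine hM.not_mem_of_descending Y (fun y hy => ?_) x ((hY x).2 ⟨hx, hx'⟩)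
    obtain ⟨hyD, hyD'⟩ := (hY y).1 hy
    rw [hD'.2, not_or] at hyD'
    rcases (hD.2 y).1 hyD with h | ⟨o, x, h₁, h₂, h₃, h⟩
    · exact absurd h hyD'.1
    · refine ⟨o, x, h₃, ?_⟩
      by_contra hw
      refine hyD'.2 ⟨o, x, h₁, h₂, h₃, fun w hw' => ?_⟩
      by_contra hwD'
      exact hw ⟨w, hw', (hY w).2 ⟨h w hw', hwD'⟩⟩
  intro D' hD'
  exact Set.Subset.antisymm (aux ⟨D', hD'.1⟩ D hD' ⟨D.2, hD⟩) (aux D ⟨D', hD'.1⟩ ⟨D.2, hD⟩ hD')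

/-- The extension of ⟨1, x⟩ is `x` itself, and a set `s ⊆ D` is coded by ⟨1, s⟩. The tags 0 and 1
keep urelements and sets apart. -/
theorem realizes_urExtension {W D : M.classes} (hD : M.IsUrDomain W D) :
    M.Realizes (M.urExtension W D) Subtype.val where
  embeds := by
    obtain ⟨E, hE⟩ := hM.exists_rel (fun x y => ∃ o z, M.IsOne o ∧ M.IsSet z ∧ M.IsOPair y o z ∧
      M.mem x z)
    obtain ⟨U, hU⟩ := hM.exists_class (fun x => ∃ e a, M.IsEmptySet e ∧ a ∈ (W : Set M.Obj) ∧
      M.IsOPair x e a)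
    exact ⟨E, D, U, Subtype.val_injective,
      fun x => ⟨fun h => ⟨⟨x, h⟩, rfl⟩, fun ⟨a, ha⟩ => ha ▸ a.2⟩,
      fun a b => (hE _ _).symm, fun a => (hU _).symm, fun Y => Iff.rfl⟩
  exists_set b := by
    rcases (hD.2 b.1).1 b.2 with ⟨e, a, he, -, hp⟩ | ⟨o, x, ho, hx, hp, hxD⟩
    · refine ⟨e, he.1, fun x => iff_of_false (he.2 x) ?_⟩
      rintro ⟨c, ⟨o, z, ho, -, hp', -⟩, -⟩
      obtain ⟨rfl, -⟩ := opair_inj hp hp'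
      exact not_isEmptySet_of_isOne ho he
    · refine ⟨x, hx, fun y => ⟨fun hy => ⟨⟨y, hxD y hy⟩, ⟨o, x, ho, hx, hp, hy⟩, rfl⟩, ?_⟩⟩
      rintro ⟨c, ⟨o', z, -, -, hp', hc⟩, rfl⟩
      obtain ⟨-, rfl⟩ := opair_inj hp hp'
      exact hc
  exists_code s hs h := by
    obtain ⟨o, ho⟩ := hM.exists_one
    obtain ⟨y, hy⟩ := hM.exists_opair o s
    refine ⟨⟨y, (hD.2 y).2 (.inr ⟨o, s, ho, hs, hy, fun w hw => ?_⟩)⟩, ?_,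
      fun a => ⟨?_, fun ha => ⟨o, s, ho, hs, hy, ha⟩⟩⟩
    · obtain ⟨a, rfl⟩ := h w hw
      exact a.2
    · rintro ⟨e, a, he, -, hp⟩
      obtain ⟨rfl, -⟩ := opair_inj hy hp
      exact not_isEmptySet_of_isOne ho he
    · rintro ⟨o', z, -, -, hp', ha⟩
      obtain ⟨-, rfl⟩ := opair_inj hy hp'
      exact ha
  ur_no_mem := by
    rintro x ⟨e, a, he, -, hp⟩ ⟨y, o, z, ho, -, hp', -⟩
    obtain ⟨rfl, -⟩ := opair_inj hp hp'
    exact not_isEmptySet_of_isOne ho he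
  ext x y hx hy h := by
    obtain ⟨o, s, ho, hs, hp, hsD⟩ := ((hD.2 x.1).1 x.2).resolve_left hx
    obtain ⟨o', s', ho', hs', hp', hsD'⟩ := ((hD.2 y.1).1 y.2).resolve_left hy
    obtain rfl := hM.isOne_unique ho ho'
    have : s = s' := hM.ext _ _ hs hs' fun z => by
      constructor
      · intro hz
        obtain ⟨o'', r, -, -, hq, hr⟩ := (h ⟨z, hsD' z hz⟩).1 ⟨o, s', ho, hs', hp', hz⟩
        obtain ⟨-, rfl⟩ := opair_inj hp hq
        exact hr
      · intro hz
        obtain ⟨o'', r, -, -, hq, hr⟩ := (h ⟨z, hsD z hz⟩).2 ⟨o, s, ho, hs, hp, hz⟩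
        obtain ⟨-, rfl⟩ := opair_inj hp' hq
        exact hr
    subst this
    exact Subtype.ext (hM.opair_unique hp hp')
  wf Y hY a ha := by
    by_contra! hmin
    refine hM.not_mem_of_descending ⟨_, hY⟩ ?_ a.1 (Set.mem_image_of_mem _ ha)
    rintro _ ⟨y, hy, rfl⟩
    obtain ⟨b, ⟨o, z, -, -, hp, hz⟩, hb⟩ := hmin y hy
    exact ⟨o, z, hp, b.1, hz, Set.mem_image_of_mem _ hb⟩

end Core
end ClassModel

/-! ### A global well-order, and Limitation of Size without urelements. -/

namespace ClassModel

/-- The class `R` of pairs is a strict well-order of all objects. -/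
structure IsWellOrder (M : ClassModel.{u}) (R : M.classes) : Prop where
  irrefl : ∀ a, ¬ M.PairInClass R a a
  trans : ∀ a b c, M.PairInClass R a b → M.PairInClass R b c → M.PairInClass R a c
  total : ∀ a b, M.PairInClass R a b ∨ a = b ∨ M.PairInClass R b a
  least : ∀ C ∈ M.classes, ∀ a, a ∈ C → ∃ m, m ∈ C ∧ ∀ b, b ∈ C → b = m ∨ M.PairInClass R m b

namespace Core

variable {M : ClassModel.{u}} (hM : M.Core)
include hM

/-- If no class were a well-order, then this would be true below some transitive set, which
contradicts Choice. -/
theorem exists_wellOrder (hAC : M.AC) : ∃ R, M.IsWellOrder R := by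
  by_contra hno
  obtain ⟨o, -⟩ := hM.exists_empty
  obtain ⟨t, ht, -, -, H⟩ := hM.reflect (β := Empty) (a := o) (b := o) (V := Empty.elim)
    (fun N _ _ _ => ¬ ∃ R : N.classes, (∀ a, ¬ N.PairInClass R a a) ∧
      (∀ a b c, N.PairInClass R a b → N.PairInClass R b c → N.PairInClass R a c) ∧
      (∀ a b, N.PairInClass R a b ∨ a = b ∨ N.PairInClass R b a) ∧
      ∀ C ∈ N.classes, ∀ a, a ∈ C → ∃ m, m ∈ C ∧ ∀ b, b ∈ C → b = m ∨ N.PairInClass R m b)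
    (fun ⟨R, h₁, h₂, h₃, h₄⟩ => hno ⟨R, h₁, h₂, h₃, h₄⟩)
  -- A set well-order of `t` yields a class well-order of `M.below t`, since the classes there are
  -- just the subsets of `t` and the pairs needed lie in `t`.
  obtain ⟨r, -, irrefl, trans, total, least⟩ := hAC t ht.trans.1
  obtain ⟨R, hR⟩ := hM.exists_class (fun z => M.mem z r)
  have key (a b : (M.below t).Obj) : (M.below t).PairInClass (hM.trace t ht.trans R) a b ↔
      M.PairInSet r a.1 b.1 :=
    (hM.below_pairInClass ht R a b).trans (exists_congr fun z => and_congr_left' (hR z))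
  refine H ⟨hM.trace t ht.trans R, ?_⟩
  simp only [key]
  refine ⟨fun a => irrefl _ a.2, fun a b c => trans _ _ _ a.2 b.2 c.2, fun a b => ?_, ?_⟩
  · rw [below_ext]
    exact total _ _ a.2 b.2
  · rintro C ⟨s, hs, hst, hC⟩ a ha
    obtain ⟨m, hm, hmin⟩ := least s hs hst ⟨a.1, (hC a).1 ha⟩
    exact ⟨⟨m, hst m hm⟩, (hC _).2 hm, fun b hb => (hmin b.1 ((hC b).1 hb)).imp below_ext.2 id⟩

/-- Without urelements, there is a well-order of all objects whose initial segments are sets: sort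
by rank first. -/
theorem exists_setLike_wellOrder (hAC : M.AC) (hur : ∀ x, ¬ M.ur x) :
    ∃ R, M.IsWellOrder R ∧ ∀ y, ∃ s, M.IsSet s ∧ ∀ x, M.PairInClass R x y → M.mem x s := by
  obtain ⟨R, hR⟩ := hM.exists_wellOrder hAC
  -- `L x y` expresses rank x ≤ rank y without mentioning ordinals: every member of `x` is bounded
  -- in rank by some member of `y`.
  obtain ⟨L, hL⟩ := hM.exists_fixRel
    (fun K x y => ∀ x', M.mem x' x → ∃ y', M.mem y' y ∧ K x' y')
    fun K K' h x y hxy x' hx' => (hxy x' hx').imp fun y' hy' => ⟨hy'.1, h _ _ hy'.2⟩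
  have refl : ∀ x, M.PairInClass L x x :=
    hM.induct (fun x => M.PairInClass L x x) fun x ih => (hL x x).2 fun y hy => ⟨y, hy, ih y hy⟩
  have trans : ∀ x y z, M.PairInClass L x y → M.PairInClass L y z → M.PairInClass L x z :=
    hM.induct (fun x => ∀ y z, M.PairInClass L x y → M.PairInClass L y z → M.PairInClass L x z)
      fun x ih y z hxy hyz => (hL x z).2 fun x' hx' => by
        obtain ⟨y', hy', h⟩ := (hL x y).1 hxy x' hx'
        obtain ⟨z', hz', h'⟩ := (hL y z).1 hyz y' hy'
        exact ⟨z', hz', ih x' hx' _ _ h h'⟩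
  have lt : ∀ x y, ¬ M.PairInClass L x y → ∃ x', M.mem x' x ∧ M.PairInClass L y x' :=
    hM.induct (fun x => ∀ y, ¬ M.PairInClass L x y → ∃ x', M.mem x' x ∧ M.PairInClass L y x')
      fun x ih y hxy => by
        rw [hL] at hxy
        push Not at hxy
        obtain ⟨x', hx', h⟩ := hxy
        exact ⟨x', hx', (hL _ _).2 fun y' hy' => ih x' hx' y' (h y' hy')⟩
  have le_of_mem : ∀ x y, M.mem x y → M.PairInClass L x y :=
    hM.induct (fun x => ∀ y, M.mem x y → M.PairInClass L x y)
      fun x ih y hxy => (hL x y).2 fun x' hx' => ⟨x, hxy, ih x' hx' x hx'⟩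
  have total x y (h : ¬ M.PairInClass L x y) : M.PairInClass L y x := by
    obtain ⟨x', hx', h⟩ := lt x y h
    exact trans _ _ _ h (le_of_mem _ _ hx')
  have set_like : ∀ y, ∃ s, M.IsSet s ∧ ∀ x, M.PairInClass L x y → M.mem x s := by
    refine hM.induct (fun y => ∃ s, M.IsSet s ∧ ∀ x, M.PairInClass L x y → M.mem x s)
      fun y ih => ?_
    -- If `t` contains a bound for each member of `y`, then every `x` of rank at most that of `y` is
    -- a subset of `t`. Having no urelements puts all such `x` in the power set.
    obtain ⟨t, ht, -, h⟩ := hM.collection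
      (fun y s => M.IsSet s ∧ ∀ x, M.PairInClass L x y → M.mem x s) y ih
    obtain ⟨p, hp, hpt⟩ := hM.exists_power t
    refine ⟨p, hp, fun x hx => (hpt x).2 ⟨hur x, fun x' hx' => ?_⟩⟩
    obtain ⟨y', hy', hxy'⟩ := (hL x y).1 hx x' hx'
    obtain ⟨b, hb, -, hb'⟩ := h y' hy'
    exact ht.trans.mem hb (hb' _ hxy')
  -- The lexicographic order: smaller rank first, and `R` among objects of equal rank.
  obtain ⟨T, hT⟩ := hM.exists_rel
    (fun x y => ¬ M.PairInClass L y x ∨ (M.PairInClass L x y ∧ M.PairInClass R x y))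
  have hTL x y (h : M.PairInClass T x y) : M.PairInClass L x y :=
    ((hT x y).1 h).elim (total _ _) And.left
  refine ⟨T, ⟨fun a ha => ?_, fun a b c h₁ h₂ => ?_, fun a b => ?_, fun C hC a ha => ?_⟩,
    fun y => ?_⟩
  · exact ((hT a a).1 ha).elim (fun h => h (refl a)) fun h => hR.irrefl a h.2
  · have hab := hTL _ _ h₁
    have hbc := hTL _ _ h₂
    rw [hT] at *
    by_cases hca : M.PairInClass L c a
    · have h₁ := h₁.resolve_left fun h => h (trans _ _ _ hbc hca)
      have h₂ := h₂.resolve_left fun h => h (trans _ _ _ hca hab)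
      exact .inr ⟨trans _ _ _ hab hbc, hR.trans _ _ _ h₁.2 h₂.2⟩
    · exact .inl hca
  · rw [hT, hT]
    have := hR.total a b
    tauto
  · lift C to M.classes using hC
    -- A member of `C` of least rank. Without one, ∈-induction on `x` shows that no member of `C`
    -- has rank at most that of `x`. The `R`-least member of that rank is then `T`-least in `C`.
    obtain ⟨m, hm, hmin⟩ : ∃ m, m ∈ (C : Set M.Obj) ∧
        ∀ b, b ∈ (C : Set M.Obj) → M.PairInClass L m b := by
      by_contra! hno
      have : ∀ x, ¬ ∃ y, y ∈ (C : Set M.Obj) ∧ M.PairInClass L y x :=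
        hM.induct (fun x => ¬ ∃ y, y ∈ (C : Set M.Obj) ∧ M.PairInClass L y x) fun x ih => by
          rintro ⟨y, hy, hyx⟩
          obtain ⟨b, hb, hyb⟩ := hno y hy
          obtain ⟨y', hy', hby'⟩ := lt y b hyb
          obtain ⟨x', hx', h⟩ := (hL y x).1 hyx y' hy'
          exact ih x' hx' ⟨b, hb, trans _ _ _ hby' h⟩
      exact this a ⟨a, ha, refl a⟩
    obtain ⟨C', hC'⟩ := hM.exists_class (fun x => x ∈ (C : Set M.Obj) ∧ M.PairInClass L x m)
    obtain ⟨n, hn, hnmin⟩ := hR.least C' C'.2 m ((hC' m).2 ⟨hm, refl m⟩)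
    obtain ⟨hnC, hnm⟩ := (hC' n).1 hn
    refine ⟨n, hnC, fun b hb => ?_⟩
    rw [hT]
    by_cases hbn : M.PairInClass L b n
    · exact (hnmin b ((hC' b).2 ⟨hb, trans _ _ _ hbn hnm⟩)).imp id
        fun h => .inr ⟨trans _ _ _ hnm (hmin b hb), h⟩
    · exact .inr (.inl hbn)
  · obtain ⟨s, hs, h⟩ := set_like y
    exact ⟨s, hs, fun x hx => h x (hTL _ _ hx)⟩

omit hM in
/-- `F` matches members of `X` with members of `Y` whose predecessors match. -/
def IsOrderMatching (M : ClassModel.{u}) (R X Y F : M.classes) : Prop :=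
  ∀ x y, M.PairInClass F x y ↔ x ∈ (X : Set M.Obj) ∧ y ∈ (Y : Set M.Obj) ∧
    (∀ x', x' ∈ (X : Set M.Obj) → M.PairInClass R x' x →
      ∃ y', y' ∈ (Y : Set M.Obj) ∧ M.PairInClass R y' y ∧ M.PairInClass F x' y') ∧
    (∀ y', y' ∈ (Y : Set M.Obj) → M.PairInClass R y' y →
      ∃ x', x' ∈ (X : Set M.Obj) ∧ M.PairInClass R x' x ∧ M.PairInClass F x' y')

theorem exists_orderMatching (R X Y : M.classes) : ∃ F, IsOrderMatching M R X Y F := by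
  refine hM.exists_fixRel (fun K x y => x ∈ (X : Set M.Obj) ∧ y ∈ (Y : Set M.Obj) ∧
    (∀ x', x' ∈ (X : Set M.Obj) → M.PairInClass R x' x →
      ∃ y', y' ∈ (Y : Set M.Obj) ∧ M.PairInClass R y' y ∧ K x' y') ∧
    (∀ y', y' ∈ (Y : Set M.Obj) → M.PairInClass R y' y →
      ∃ x', x' ∈ (X : Set M.Obj) ∧ M.PairInClass R x' x ∧ K x' y')) ?_
  rintro K K' h x y ⟨hx, hy, h₁, h₂⟩
  exact ⟨hx, hy, fun x' hx hx' => (h₁ x' hx hx').imp fun _ h' => ⟨h'.1, h'.2.1, h _ _ h'.2.2⟩,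
    fun x' hx hx' => (h₂ x' hx hx').imp fun _ h' => ⟨h'.1, h'.2.1, h _ _ h'.2.2⟩⟩

omit hM in
theorem IsOrderMatching.flip {R X Y F F' : M.classes} (hF : IsOrderMatching M R X Y F)
    (hF' : ∀ a b, M.PairInClass F' a b ↔ M.PairInClass F b a) : IsOrderMatching M R Y X F' := by
  intro y x
  simp only [hF']
  refine (hF x y).trans ?_
  tauto

/-- Take the least `x` with two partners `y < z`. Below `z`, `y` is the partner of some `x' < x`;
below `x`, this `x'` has a partner `y' < y`. So `x'` is a smaller example. -/
theorem IsOrderMatching.unique {R X Y F : M.classes} (hF : IsOrderMatching M R X Y F)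
    (hR : M.IsWellOrder R) {x y z : M.Obj} (h : M.PairInClass F x y) (h' : M.PairInClass F x z) :
    y = z := by
  obtain ⟨B, hB⟩ := hM.exists_class (fun x => ∃ y z, M.PairInClass F x y ∧ M.PairInClass F x z ∧
    M.PairInClass R y z)
  have key x : x ∉ (B : Set M.Obj) := by
    intro hx
    obtain ⟨m, hm, hmin⟩ := hR.least B B.2 x hx
    obtain ⟨y, z, hy, hz, hyz⟩ := (hB m).1 hm
    obtain ⟨hmX, hyY, hF₁, -⟩ := (hF _ _).1 hy
    obtain ⟨x', hx', hxm, hxy⟩ := ((hF _ _).1 hz).2.2.2 y hyY hyz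
    obtain ⟨y', hy', hyy', hxy'⟩ := hF₁ x' hx' hxm
    rcases hmin x' ((hB x').2 ⟨y', y, hxy', hxy, hyy'⟩) with rfl | h
    exacts [hR.irrefl _ hxm, hR.irrefl _ (hR.trans _ _ _ h hxm)]
  rcases hR.total y z with hyz | hyz | hyz
  · exact absurd ((hB x).2 ⟨y, z, h, h', hyz⟩) (key x)
  · exact hyz
  · exact absurd ((hB x).2 ⟨z, y, h', h, hyz⟩) (key x)

omit hM in
-- Everything in `Y` below a matched element is matched.
theorem IsOrderMatching.lt {R X Y F : M.classes} (hF : IsOrderMatching M R X Y F)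
    (hR : M.IsWellOrder R) {x y z : M.Obj} (h : M.PairInClass F x y) (hz : z ∈ (Y : Set M.Obj))
    (hz' : ¬ ∃ x, M.PairInClass F x z) : M.PairInClass R y z := by
  rcases hR.total y z with hyz | rfl | hzy
  · exact hyz
  · exact absurd ⟨x, h⟩ hz'
  · obtain ⟨x', -, -, hx'⟩ := ((hF _ _).1 h).2.2.2 z hz hzy
    exact absurd ⟨x', hx'⟩ hz'

/-- If `X` is a proper class, then a matching that is total on `X` is onto. -/
theorem IsOrderMatching.surj {R X Y F F' : M.classes} (hF : IsOrderMatching M R X Y F)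
    (hF' : ∀ a b, M.PairInClass F' a b ↔ M.PairInClass F b a)
    (hR : M.IsWellOrder R)
    (hRs : ∀ y, ∃ s, M.IsSet s ∧ ∀ x, M.PairInClass R x y → M.mem x s) (hX : M.IsProper X)
    (hdom : ∀ x, x ∈ (X : Set M.Obj) → ∃ y, M.PairInClass F x y) {y : M.Obj}
    (hy : y ∈ (Y : Set M.Obj)) : ∃ x, M.PairInClass F x y := by
  by_contra hy'
  obtain ⟨s, hs, hsy⟩ := hRs y
  -- If `y` is missed, the range of `F` lies in the initial segment below `y`, which is included in
  -- a set. Replacement for the inverse of `F` would then make `X` a set.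
  obtain ⟨r, hr, hrs⟩ := hM.exists_sep hs (fun z => ∃ x, M.PairInClass F x z)
    fun z ⟨x, hx⟩ => hsy z (hF.lt hR hx hy hy')
  obtain ⟨p, hp, hpr⟩ := hM.exists_image (fun z x => M.PairInClass F x z) r fun z hz => by
    obtain ⟨x, hx⟩ := (hrs z).1 hz
    exact ⟨x, hx, fun x' hx' => unique hM (hF.flip hF') hR ((hF' _ _).2 hx') ((hF' _ _).2 hx)⟩
  refine hX ⟨p, hp, fun x => (hpr x).trans ⟨fun ⟨z, _, hxz⟩ => ((hF _ _).1 hxz).1, fun hx => ?_⟩⟩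
  obtain ⟨z, hz⟩ := hdom x hx
  exact ⟨z, (hrs z).2 ⟨x, hz⟩, hz⟩

/-- `KM + RP₂` proves Limitation of Size. -/
theorem limitationOfSize (hAC : M.AC) (hur : ∀ x, ¬ M.ur x) : M.LimitationOfSize := by
  intro X hX Y hY hpX hpY
  lift X to M.classes using hX
  lift Y to M.classes using hY
  obtain ⟨R, hR, hRs⟩ := hM.exists_setLike_wellOrder hAC hur
  obtain ⟨F, hF⟩ := hM.exists_orderMatching R X Y
  obtain ⟨F', hF'⟩ := hM.exists_rel (fun x y => M.PairInClass F y x)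
  have hF'' a b : M.PairInClass F a b ↔ M.PairInClass F' b a := (hF' _ _).symm
  have hflip := hF.flip hF'
  have hor : (∀ x, x ∈ (X : Set M.Obj) → ∃ y, M.PairInClass F x y) ∨
      ∀ y, y ∈ (Y : Set M.Obj) → ∃ x, M.PairInClass F x y := by
    by_contra! hno
    obtain ⟨⟨x₀, hx₀, hx₀'⟩, y₀, hy₀, hy₀'⟩ := hno
    obtain ⟨A, hA⟩ := hM.exists_class
      (fun x => x ∈ (X : Set M.Obj) ∧ ¬ ∃ y, M.PairInClass F x y)
    obtain ⟨B, hB⟩ := hM.exists_class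
      (fun y => y ∈ (Y : Set M.Obj) ∧ ¬ ∃ x, M.PairInClass F x y)
    obtain ⟨x, hx, hxmin⟩ := hR.least A A.2 x₀ ((hA _).2 ⟨hx₀, by simpa using hx₀'⟩)
    obtain ⟨y, hy, hymin⟩ := hR.least B B.2 y₀ ((hB _).2 ⟨hy₀, by simpa using hy₀'⟩)
    obtain ⟨hxX, hx'⟩ := (hA x).1 hx
    obtain ⟨hyY, hy'⟩ := (hB y).1 hy
    -- If neither side were exhausted, the least unmatched elements of the two sides would match
    -- each other.
    refine hx' ⟨y, (hF x y).2 ⟨hxX, hyY, fun x' hx'X hlt => ?_, fun y' hy'Y hlt => ?_⟩⟩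
    · have : ∃ y', M.PairInClass F x' y' := by
        by_contra h
        rcases hxmin x' ((hA _).2 ⟨hx'X, h⟩) with rfl | h
        exacts [hR.irrefl _ hlt, hR.irrefl _ (hR.trans _ _ _ h hlt)]
      obtain ⟨y', h⟩ := this
      exact ⟨y', ((hF _ _).1 h).2.1, hF.lt hR h hyY hy', h⟩
    · have : ∃ x', M.PairInClass F x' y' := by
        by_contra h
        rcases hymin y' ((hB _).2 ⟨hy'Y, h⟩) with rfl | h
        exacts [hR.irrefl _ hlt, hR.irrefl _ (hR.trans _ _ _ h hlt)]
      obtain ⟨x', h⟩ := this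
      exact ⟨x', ((hF _ _).1 h).1, hflip.lt hR ((hF' _ _).2 h) hxX (by simpa [hF'] using hx'), h⟩
  have hdom : ∀ x, x ∈ (X : Set M.Obj) → ∃ y, M.PairInClass F x y := by
    refine hor.elim id fun h x hx => ?_
    simpa [hF'] using hflip.surj hM hF'' hR hRs hpY (fun y hy => by simpa [hF'] using h y hy) hx
  refine ⟨F, F.2, fun x hx => ?_, fun y hy => ?_⟩
  · obtain ⟨y, hy⟩ := hdom x hx
    exact ⟨y, ⟨((hF _ _).1 hy).2.1, hy⟩, fun z hz => hF.unique hM hR hz.2 hy⟩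
  · obtain ⟨x, hx⟩ := hF.surj hM hF' hR hRs hpX hdom hy
    exact ⟨x, ⟨((hF _ _).1 hx).1, hx⟩,
      fun z hz => hflip.unique hM hR ((hF' _ _).2 hz.2) ((hF' _ _).2 hx)⟩

end Core
end ClassModel

/-! ### The interpretations and their codings. -/

namespace ClassModel

/-- A formula for a relation that is definable without parameters. -/
noncomputable def formulaOf {α β : Type}
    (R : ∀ M : ClassModel.{u}, (α → M.Obj) → (β → M.classes) → Prop)
    [h : Dfn False (fun M : ClassModel.{u} => M) R] : Fml α β := h.exists_formula.choose

theorem sat_formulaOf {α β : Type}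
    (R : ∀ M : ClassModel.{u}, (α → M.Obj) → (β → M.classes) → Prop)
    [h : Dfn False (fun M : ClassModel.{u} => M) R] (M : ClassModel.{u}) (v : α → M.Obj)
    (V : β → M.classes) : M.Sat (formulaOf R) v V ↔ R M v V :=
  h.exists_formula.choose_spec M v V

end ClassModel

namespace Interpretation

open ClassModel

/-- An interpretation that codes objects by objects and classes by classes, with equality and
membership in classes interpreted as such. -/
abbrev plain {pc : ℕ} (adm : Fml (Fin 0) (Fin pc)) (domO : Fml (Fin 0 ⊕ Fin 1) (Fin pc ⊕ Fin 0))
    (domC : Fml (Fin 0 ⊕ Fin 0) (Fin pc ⊕ Fin 1))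
    (memO : Fml (Fin 0 ⊕ (Fin 1 ⊕ Fin 1)) (Fin pc ⊕ (Fin 0 ⊕ Fin 0)))
    (ur : Fml (Fin 0 ⊕ Fin 1) (Fin pc ⊕ Fin 0)) : Interpretation where
  po := 0
  pc := pc
  oo := 1
  oc := 0
  co := 0
  cc := 1
  adm := adm
  domO := domO
  domC := domC
  eqO := .eqO (.inr (.inl 0)) (.inr (.inr 0))
  memO := memO
  ur := ur
  memC := .memC (.inr (.inl 0)) (.inr (.inr 0))

/-- The coding of objects by their images under `e`. -/
def imgO {M N : ClassModel.{u}} (e : N.Obj → M.Obj) (s : M.Tup (Fin 1) (Fin 0)) (a : N.Obj) :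
    Prop := s.1 0 = e a

/-- The coding of classes by their images under `e`. -/
def imgC {M N : ClassModel.{u}} (e : N.Obj → M.Obj) (s : M.Tup (Fin 0) (Fin 1)) (A : N.classes) :
    Prop := (s.2 0 : Set M.Obj) = e '' A

variable {pc : ℕ} {adm : Fml (Fin 0) (Fin pc)} {domO : Fml (Fin 0 ⊕ Fin 1) (Fin pc ⊕ Fin 0)}
  {domC : Fml (Fin 0 ⊕ Fin 0) (Fin pc ⊕ Fin 1)}
  {memO : Fml (Fin 0 ⊕ (Fin 1 ⊕ Fin 1)) (Fin pc ⊕ (Fin 0 ⊕ Fin 0))}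
  {ur : Fml (Fin 0 ⊕ Fin 1) (Fin pc ⊕ Fin 0)} {M N K : ClassModel.{u}}

theorem isCoding_plain {p : M.Tup (Fin 0) (Fin pc)} {e : N.Obj → M.Obj}
    (inj : Function.Injective e) (classes : ∀ Y, Y ∈ N.classes ↔ e '' Y ∈ M.classes)
    (hO : ∀ s, M.Sat₂ domO p s ↔ ∃ a, s.1 0 = e a)
    (hC : ∀ s, M.Sat₂ domC p s ↔ ∀ x, x ∈ (s.2 0 : Set M.Obj) → ∃ a, x = e a)
    (hmem : ∀ s t a b, s.1 0 = e a → t.1 0 = e b → (M.Sat₃ memO p s t ↔ N.mem a b))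
    (hur : ∀ s a, s.1 0 = e a → (M.Sat₂ ur p s ↔ N.ur a)) :
    (plain adm domO domC memO ur).IsCoding M p N (imgO e) (imgC e) where
  domO := hO
  domC s := by
    refine (hC s).trans ⟨fun h => ?_, ?_⟩
    · have : e '' (e ⁻¹' (s.2 0 : Set M.Obj)) = (s.2 0 : Set M.Obj) :=
        Set.image_preimage_eq_of_subset fun x hx => by
          obtain ⟨a, ha⟩ := h x hx
          exact ⟨a, ha.symm⟩
      exact ⟨⟨_, (classes (e ⁻¹' (s.2 0 : Set M.Obj))).2 (by rw [this]; exact (s.2 0).2)⟩, this.symm⟩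
    · rintro ⟨A, hA⟩ x hx
      rw [hA] at hx
      obtain ⟨a, -, rfl⟩ := hx
      exact ⟨a, rfl⟩
  surjO a := ⟨(fun _ => e a, Fin.elim0), rfl⟩
  surjC A := ⟨(Fin.elim0, fun _ => ⟨e '' A, (classes _).1 A.2⟩), rfl⟩
  eqO s t a b hs ht := by
    change s.1 0 = e a at hs
    change t.1 0 = e b at ht
    change s.1 0 = t.1 0 ↔ a = b
    rw [hs, ht, inj.eq_iff]
  memO := hmem
  ur := hur
  memC s t a A hs ht := by
    change s.1 0 = e a at hs
    change (t.2 0 : Set M.Obj) = e '' A at ht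
    change s.1 0 ∈ (t.2 0 : Set M.Obj) ↔ _
    rw [hs, ht, inj.mem_set_image]

/-- A structure can be replaced by an isomorphic one. -/
theorem IsCoding.of_isIso {p : M.Tup (Fin 0) (Fin pc)} {e : N.Obj → M.Obj}
    (h : (plain adm domO domC memO ur).IsCoding M p N (imgO e) (imgC e)) (f : N.Obj ≃ K.Obj)
    (hf : IsIso N K f) :
    (plain adm domO domC memO ur).IsCoding M p K (imgO (e ∘ f.symm)) (imgC (e ∘ f.symm)) where
  domO s := (h.domO s).trans ⟨fun ⟨a, ha⟩ => ⟨f a, by simpa [imgO] using ha⟩,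
    fun ⟨a, ha⟩ => ⟨f.symm a, ha⟩⟩
  domC s := (h.domC s).trans
    ⟨fun ⟨A, hA⟩ => ⟨⟨f '' A, (hf.classes _).1 A.2⟩, hA.trans (by
      rw [Set.image_comp, Equiv.symm_image_image])⟩,
    fun ⟨A, hA⟩ => ⟨⟨f.symm '' A, (hf.classes _).2 (by
      rw [Equiv.image_symm_image]; exact A.2)⟩, hA.trans (Set.image_comp ..)⟩⟩
  surjO a := h.surjO (f.symm a)
  surjC A := by
    obtain ⟨s, hs⟩ := h.surjC ⟨f.symm '' A, (hf.classes _).2 (by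
      rw [Equiv.image_symm_image]; exact A.2)⟩
    exact ⟨s, hs.trans (Set.image_comp ..).symm⟩
  eqO s t a b hs ht := (h.eqO s t _ _ hs ht).trans f.symm.injective.eq_iff
  memO s t a b hs ht := (h.memO s t _ _ hs ht).trans ((hf.mem _ _).trans (by simp))
  ur s a hs := (h.ur s _ hs).trans ((hf.ur _).trans (by simp))
  memC s t a A hs ht := by
    refine (h.memC s t (f.symm a) ⟨f.symm '' A, (hf.classes _).2 (by
      rw [Equiv.image_symm_image]; exact A.2)⟩ hs (ht.trans (Set.image_comp ..))).trans ?_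
    exact f.symm.injective.mem_set_image

variable {pc' : ℕ} {adm' : Fml (Fin 0) (Fin pc')}
  {domO' : Fml (Fin 0 ⊕ Fin 1) (Fin pc' ⊕ Fin 0)}
  {domC' : Fml (Fin 0 ⊕ Fin 0) (Fin pc' ⊕ Fin 1)}
  {memO' : Fml (Fin 0 ⊕ (Fin 1 ⊕ Fin 1)) (Fin pc' ⊕ (Fin 0 ⊕ Fin 0))}
  {ur' : Fml (Fin 0 ⊕ Fin 1) (Fin pc' ⊕ Fin 0)}

/-- The pair of an object and its image belongs to the parameter. -/
noncomputable def isoFormulaO : Fml (Fin 0 ⊕ (((Fin 1 × Fin 1) ⊕ (Fin 0 × Fin 0)) ⊕ Unit))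
    (Fin 1 ⊕ (((Fin 1 × Fin 0) ⊕ (Fin 0 × Fin 1)) ⊕ Empty)) :=
  formulaOf.{u} fun M v V =>
    M.PairInClass (V (.inl 0)) (v (.inr (.inl (.inl (0, 0))))) (v (.inr (.inr ())))

/-- A class is the preimage of another one under the parameter. -/
noncomputable def isoFormulaC : Fml (Fin 0 ⊕ (((Fin 0 × Fin 1) ⊕ (Fin 1 × Fin 0)) ⊕ Empty))
    (Fin 1 ⊕ (((Fin 0 × Fin 0) ⊕ (Fin 1 × Fin 1)) ⊕ Unit)) :=
  formulaOf.{u} fun M _ V => ∀ s, s ∈ (V (.inr (.inl (.inr (0, 0)))) : Set M.Obj) ↔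
    ∃ x, x ∈ (V (.inr (.inr ())) : Set M.Obj) ∧ M.PairInClass (V (.inl 0)) s x

theorem sat_isoFormulaO (v V) : M.Sat isoFormulaO.{u} v V ↔
    M.PairInClass (V (.inl 0)) (v (.inr (.inl (.inl (0, 0))))) (v (.inr (.inr ()))) :=
  sat_formulaOf ..

theorem sat_isoFormulaC (v V) : M.Sat isoFormulaC.{u} v V ↔
    ∀ s, s ∈ (V (.inr (.inl (.inr (0, 0)))) : Set M.Obj) ↔
      ∃ x, x ∈ (V (.inr (.inr ())) : Set M.Obj) ∧ M.PairInClass (V (.inl 0)) s x :=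
  sat_formulaOf ..

/-- Isomorphisms that are given as a class of pairs. -/
noncomputable def plainIso : IsoFormulas (plain adm domO domC memO ur)
    (plain adm' domO' domC' memO' ur') where
  po := 0
  pc := 1
  onO := isoFormulaO.{u}
  onC := isoFormulaC.{u}

/-- The code of `y` in `N` is `e₂ y`, whose code in `M` is `e₁ (e₂ y)`. So a class of the pairs ⟨e₁
(e₂ y), y⟩ serves as the parameter that defines the isomorphism. -/
theorem definesIso_plainIso {e₁ : N.Obj → M.Obj} {e₂ : M.Obj → N.Obj}
    (hc₂ : ∀ Y, Y ∈ M.classes ↔ e₂ '' Y ∈ N.classes)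
    (H : M.classes) (hH : ∀ x y, M.PairInClass H x y ↔ x = e₁ (e₂ y)) :
    DefinesIso (plainIso.{u} (adm := adm) (domO := domO) (domC := domC) (memO := memO) (ur := ur)
      (adm' := adm') (domO' := domO') (domC' := domC') (memO' := memO') (ur' := ur'))
      M N (Fin.elim0, fun _ => H) (imgO e₁) (imgC e₁) (imgO e₂) (imgC e₂) := by
  constructor
  · intro s t x
    refine (sat_isoFormulaO _ _).trans ?_
    change M.PairInClass H ((s 0).1 0) x ↔ _
    rw [hH]
    constructor
    · intro h
      refine ⟨(fun _ => e₂ x, Fin.elim0), fun i => ?_, fun j => j.elim0, rfl⟩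
      obtain rfl := Subsingleton.elim i 0
      exact h
    · rintro ⟨n, hn, -, hx⟩
      have h₁ : (s 0).1 0 = e₁ (n.1 0) := hn 0
      have h₂ : n.1 0 = e₂ x := hx
      rw [h₁, h₂]
  · intro s t X
    refine (sat_isoFormulaC _ _).trans ?_
    change (∀ s, s ∈ ((t 0).2 0 : Set M.Obj) ↔
      ∃ x, x ∈ (X : Set M.Obj) ∧ M.PairInClass H s x) ↔ _
    have key : (∀ s, s ∈ ((t 0).2 0 : Set M.Obj) ↔
        ∃ x, x ∈ (X : Set M.Obj) ∧ M.PairInClass H s x) ↔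
        ((t 0).2 0 : Set M.Obj) = e₁ '' (e₂ '' X) := by
      rw [Set.ext_iff]
      refine forall_congr' fun s => iff_congr Iff.rfl ?_
      simp [hH, eq_comm]
    rw [key]
    constructor
    · intro h
      refine ⟨(Fin.elim0, fun _ => ⟨e₂ '' X, (hc₂ _).1 X.2⟩), fun i => i.elim0, fun j => ?_, rfl⟩
      obtain rfl := Subsingleton.elim j 0
      exact h
    · rintro ⟨n, -, hn, hx⟩
      have h₁ : ((t 0).2 0 : Set M.Obj) = e₁ '' (n.2 0) := hn 0
      have h₂ : (n.2 0 : Set N.Obj) = e₂ '' X := hx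
      rw [h₁, h₂]

/-- The interpretation of `V⟦W⟧`. -/
noncomputable def urInterpretation : Interpretation :=
  plain (pc := 1) (formulaOf.{u} fun _ _ _ => True)
    -- Only `W` is a parameter; the domain `D` is determined by `W` and can be quantified.
    (formulaOf.{u} fun M v V => ∃ D : M.classes, M.IsUrDomain (V (.inl 0)) D ∧
      v (.inr 0) ∈ (D : Set M.Obj))
    (formulaOf.{u} fun M _ V => ∃ D : M.classes, M.IsUrDomain (V (.inl 0)) D ∧
      ∀ x, x ∈ (V (.inr 0) : Set M.Obj) → x ∈ (D : Set M.Obj))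
    (formulaOf.{u} fun M v _ => ∃ o z, M.IsOne o ∧ M.IsSet z ∧ M.IsOPair (v (.inr (.inr 0))) o z ∧
      M.mem (v (.inr (.inl 0))) z)
    (formulaOf.{u} fun M v V => ∃ e a, M.IsEmptySet e ∧ a ∈ (V (.inl 0) : Set M.Obj) ∧
      M.IsOPair (v (.inr 0)) e a)

/-- The interpretation of the pure part. -/
noncomputable def pureInterpretation : Interpretation :=
  plain (pc := 0) (formulaOf.{u} fun _ _ _ => True)
    (formulaOf.{u} fun M v _ => M.IsPure (v (.inr 0)))
    (formulaOf.{u} fun M _ V => ∀ x, x ∈ (V (.inr 0) : Set M.Obj) → M.IsPure x)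
    (formulaOf.{u} fun M v _ => M.mem (v (.inr (.inl 0))) (v (.inr (.inr 0))))
    (formulaOf.{u} fun M v _ => M.ur (v (.inr 0)))

theorem admissible_urInterpretation (p) : urInterpretation.{u}.Admissible M p :=
  (sat_formulaOf (α := Fin 0) (β := Fin 1) (fun _ _ _ => True) M p.1 p.2).2 trivial

theorem admissible_pureInterpretation (p) : pureInterpretation.{u}.Admissible M p :=
  (sat_formulaOf (α := Fin 0) (β := Fin 0) (fun _ _ _ => True) M p.1 p.2).2 trivial

theorem isCoding_urInterpretation (hM : M.Core) (p : M.Tup (Fin 0) (Fin 1)) {D : M.classes}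
    (hD : M.IsUrDomain (p.2 0) D) :
    urInterpretation.{u}.IsCoding M p (M.urExtension (p.2 0) D) (imgO Subtype.val)
      (imgC Subtype.val) := by
  have hu (D' : M.classes) (hD' : M.IsUrDomain (p.2 0) D') : D' = D :=
    Subtype.ext ((hM.existsUnique_isUrDomain (p.2 0)).unique hD' hD)
  refine isCoding_plain Subtype.val_injective (fun Y => Iff.rfl) (fun s => ?_) (fun s => ?_)
    (fun s t a b hs ht => ?_) (fun s a hs => ?_)
  · refine (sat_formulaOf ..).trans ⟨fun ⟨D', hD', h⟩ => ⟨⟨s.1 0, hu D' hD' ▸ h⟩, rfl⟩, ?_⟩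
    rintro ⟨a, ha⟩
    refine ⟨D, hD, ?_⟩
    change s.1 0 ∈ (D : Set M.Obj)
    rw [ha]
    exact a.2
  · refine (sat_formulaOf ..).trans
      ⟨fun ⟨D', hD', h⟩ x hx => ⟨⟨x, hu D' hD' ▸ h x hx⟩, rfl⟩, fun h => ⟨D, hD, fun x hx => ?_⟩⟩
    obtain ⟨a, rfl⟩ := h x hx
    exact a.2
  · refine (sat_formulaOf ..).trans ?_
    change (∃ o z, M.IsOne o ∧ M.IsSet z ∧ M.IsOPair (t.1 0) o z ∧ M.mem (s.1 0) z) ↔ _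
    rw [hs, ht]
    rfl
  · refine (sat_formulaOf ..).trans ?_
    change (∃ e a, M.IsEmptySet e ∧ a ∈ (p.2 0 : Set M.Obj) ∧ M.IsOPair (s.1 0) e a) ↔ _
    rw [hs]
    rfl

theorem isCoding_pureInterpretation (p : M.Tup (Fin 0) (Fin 0)) :
    pureInterpretation.{u}.IsCoding M p M.purePart (imgO Subtype.val) (imgC Subtype.val) := by
  refine isCoding_plain Subtype.val_injective (fun Y => Iff.rfl) (fun s => ?_) (fun s => ?_)
    (fun s t a b hs ht => ?_) (fun s a hs => ?_)
  · refine (sat_formulaOf ..).trans ⟨fun h => ⟨⟨s.1 0, h⟩, rfl⟩, ?_⟩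
    rintro ⟨a, ha⟩
    exact (ha ▸ a.2 : M.IsPure (s.1 0))
  · refine (sat_formulaOf ..).trans ⟨fun h x hx => ⟨⟨x, h x hx⟩, rfl⟩, fun h x hx => ?_⟩
    obtain ⟨a, rfl⟩ := h x hx
    exact a.2
  · refine (sat_formulaOf ..).trans ?_
    change M.mem (s.1 0) (t.1 0) ↔ _
    rw [hs, ht]
    rfl
  · refine (sat_formulaOf ..).trans ?_
    change M.ur (s.1 0) ↔ _
    rw [hs]
    rfl

end Interpretation

/-! ### The models, the two isomorphisms and the theorem. -/

namespace ClassModel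

/-- `KM + RP₂` is preserved by passing to `V⟦W⟧`, except that there are urelements. -/
theorem urExtension_models {M : ClassModel.{u}} (hM : M.IsKM) (hR : M.RP2) {W D : M.classes}
    (hD : M.IsUrDomain W D) : (M.urExtension W D).IsKMU ∧ (M.urExtension W D).RP2 ∧
      (M.urExtension W D).LimitationOfSize := by
  have hc := hM.kmu.core hR
  have h := hc.realizes_urExtension hD
  exact ⟨h.isKMU hc hM.kmu.choice, h.rp2 hc,
    h.limitationOfSize hc (hc.limitationOfSize hM.kmu.choice hM.no_ur)⟩

theorem purePart_models {M : ClassModel.{u}} (hM : M.IsKMU) (hR : M.RP2) :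
    M.purePart.IsKM ∧ M.purePart.RP2 := by
  have hc := hM.core hR
  have h := hc.realizes_purePart
  exact ⟨⟨h.isKMU hc hM.choice, Core.purePart_no_ur⟩, h.rp2 hc⟩

/-- A model of `KM + RP₂` is isomorphic to the pure part of its extensions by urelements. -/
theorem exists_iso_purePart_urExtension {M : ClassModel.{u}} (hM : M.Core) (hur : ∀ x, ¬ M.ur x)
    {W D : M.classes} (hD : M.IsUrDomain W D) :
    ∃ (H : M.classes) (f : (M.urExtension W D).purePart.Obj ≃ M.Obj),
      IsIso (M.urExtension W D).purePart M f ∧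
      ∀ x y, M.PairInClass H x y ↔ x = (f.symm y).1.1 := by
  have h := hM.realizes_urExtension hD
  have h' := h.trans hM (h.core hM).realizes_purePart
  -- Neither structure has urelements, so any class can stand for the bijection between them; `W` is
  -- at hand.
  obtain ⟨H, f, hf, hH⟩ := h'.exists_iso hM hM.realizes_id W
    (fun a ha => absurd ha (Core.purePart_no_ur a)) (fun b hb => absurd hb (hur b))
  refine ⟨H, f, hf, fun x y => (hH x y).trans ⟨?_, fun hx => ⟨f.symm y, hx, by simp⟩⟩⟩
  rintro ⟨a, rfl, rfl⟩
  exact congrArg (fun z => z.1.1) (f.symm_apply_apply a).symm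

/-- A model of `KMU + RP₂ + Limitation of Size` is isomorphic to an extension of its pure part by
urelements: the class of urelements is in bijection with a class of pure sets. -/
theorem exists_iso_urExtension_purePart {M : ClassModel.{u}} (hM : M.Core)
    (hL : M.LimitationOfSize) :
    ∃ (W D : M.purePart.classes), M.purePart.IsUrDomain W D ∧
    ∃ (H : M.classes) (f : (M.purePart.urExtension W D).Obj ≃ M.Obj),
      IsIso (M.purePart.urExtension W D) M f ∧
      ∀ x y, M.PairInClass H x y ↔ x = (f.symm y).1.1 := by
  have h := hM.realizes_purePart
  have hN := h.core hM
  -- The urelements may form a set; adding the pure sets gives a proper class to which Limitation of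
  -- Size applies. `W` is then the image of the urelements among the pure sets.
  obtain ⟨A, hA⟩ := hM.exists_class (fun x => M.ur x ∨ M.IsPure x)
  obtain ⟨P, hP⟩ := hM.exists_class (fun x => M.IsPure x)
  obtain ⟨F, hF, hF₁, hF₂⟩ := hL A A.2 P P.2 (hM.isProper_pure fun x hx => (hA x).2 (.inr hx))
    (hM.isProper_pure fun x hx => (hP x).2 hx)
  lift F to M.classes using hF
  obtain ⟨W, hW⟩ := h.exists_class hM (fun x => ∃ a, M.ur a ∧ M.PairInClass F a x)
  obtain ⟨D, hD, -⟩ := hN.existsUnique_isUrDomain W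
  lift D to M.purePart.classes using hD.1
  obtain ⟨Q, hQ⟩ := h.exists_rel_img hM
    (fun x w => ∃ e, M.purePart.IsEmptySet e ∧ M.purePart.IsOPair x e w)
  -- `G` pairs the new urelement ⟨0, w⟩, formed in the pure part, with the urelement that `F` sends
  -- to `w`.
  obtain ⟨G, hG⟩ := hM.exists_rel (fun x y => ∃ w, M.PairInClass Q x w ∧ M.PairInClass F y w)
  have h' := h.trans hM (hN.realizes_urExtension hD)
  obtain ⟨H, f, hf, hH⟩ := h'.exists_iso hM hM.realizes_id G (by
    rintro a ⟨e, w, he, hw, hp⟩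
    obtain ⟨b, hb, hbw⟩ := (hW w).1 hw
    refine ⟨b, ⟨hb, (hG _ _).2 ⟨w.1, (hQ _ _).2 ⟨a.1, w, rfl, rfl, e, he, hp⟩, hbw⟩⟩, ?_⟩
    rintro c ⟨hc, hac⟩
    obtain ⟨_, hw', hcw⟩ := (hG _ _).1 hac
    obtain ⟨a', w', ha', rfl, e', -, hp'⟩ := (hQ _ _).1 hw'
    obtain rfl := Subtype.ext ha'
    obtain ⟨-, rfl⟩ := Core.opair_inj hp hp'
    exact (hF₂ w.1 ((hP _).2 w.2)).unique ⟨(hA _).2 (.inl hc), hcw⟩ ⟨(hA _).2 (.inl hb), hbw⟩) (by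
    intro b hb
    obtain ⟨y, ⟨hy, hby⟩, hu⟩ := hF₁ b ((hA b).2 (.inl hb))
    let w : M.purePart.Obj := ⟨y, (hP y).1 hy⟩
    have hw : w ∈ (W : Set M.purePart.Obj) := (hW w).2 ⟨b, hb, hby⟩
    obtain ⟨e, he⟩ := hN.exists_empty
    obtain ⟨x, hx⟩ := hN.exists_opair e w
    refine ⟨⟨x, (hD.2 x).2 (.inl ⟨e, w, he, hw, hx⟩)⟩, ⟨⟨e, w, he, hw, hx⟩,
      (hG _ _).2 ⟨y, (hQ _ _).2 ⟨x, w, rfl, rfl, e, he, hx⟩, hby⟩⟩, ?_⟩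
    rintro c ⟨-, hc⟩
    obtain ⟨_, hw', hbw⟩ := (hG _ _).1 hc
    obtain ⟨c', w', hc', rfl, e', he', hp'⟩ := (hQ _ _).1 hw'
    obtain rfl := hN.isEmptySet_unique he he'
    obtain rfl : w' = w := Subtype.ext (hu _ ⟨(hP _).2 w'.2, hbw⟩)
    obtain rfl : c' = c.1 := Subtype.ext hc'
    exact Subtype.ext (hN.opair_unique hp' hx))
  refine ⟨W, D, hD, H, f, hf, fun x y => (hH x y).trans ⟨?_, fun hx => ⟨f.symm y, hx, by simp⟩⟩⟩
  rintro ⟨a, rfl, rfl⟩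
  exact congrArg (fun z => z.1.1) (f.symm_apply_apply a).symm

end ClassModel

open ClassModel Interpretation in
/-- `KM + RP₂` and `KMU + RP₂ + Limitation of Size` are bi-interpretable. -/
theorem biInterpretable_km_kmu :
    BiInterpretable.{u} (fun M => M.IsKM ∧ M.RP2)
      (fun M => M.IsKMU ∧ M.RP2 ∧ M.LimitationOfSize) := by
  refine ⟨urInterpretation.{u}, pureInterpretation.{u}, plainIso.{u}, plainIso.{u}, ?_, ?_⟩
  · rintro M ⟨hM, hR⟩
    have hc := hM.kmu.core hR
    -- Every class is admissible as `W`; the universal class shows that there is one.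
    obtain ⟨o, -⟩ := hc.exists_class (fun x => x = x)
    refine ⟨⟨(Fin.elim0, fun _ => o), admissible_urInterpretation _⟩, fun p _ => ?_⟩
    obtain ⟨D, hD, -⟩ := hc.existsUnique_isUrDomain (p.2 (0 : Fin 1))
    lift D to M.classes using hD.1
    obtain ⟨H, f, hf, hH⟩ := exists_iso_purePart_urExtension hc hM.no_ur hD
    have hJ := (isCoding_pureInterpretation (M := M.urExtension (p.2 (0 : Fin 1)) D)
      (Fin.elim0, Fin.elim0)).of_isIso f hf
    refine ⟨_, _, _, isCoding_urInterpretation hc p hD, urExtension_models hM hR hD,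
      (Fin.elim0, Fin.elim0), _, _, (Fin.elim0, fun _ => H), admissible_pureInterpretation _, hJ, ?_⟩
    refine definesIso_plainIso (fun Y => ?_) H hH
    refine (hf.classes_symm Y).trans (iff_of_eq ?_)
    exact congrArg (· ∈ ClassModel.classes _) (Set.image_comp Subtype.val f.symm Y).symm
  · rintro M ⟨hM, hR, hL⟩
    have hc := hM.core hR
    refine ⟨⟨(Fin.elim0, Fin.elim0), admissible_pureInterpretation _⟩, fun p _ => ?_⟩
    -- Here the parameter matters: `W` must copy the urelements of `M`, and Limitation of Size
    -- supplies it as a class of the pure part.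
    obtain ⟨W, D, hD, H, f, hf, hH⟩ := exists_iso_urExtension_purePart hc hL
    have hJ := (isCoding_urInterpretation (hc.realizes_purePart.core hc)
      (Fin.elim0, fun _ => W) hD).of_isIso f hf
    refine ⟨_, _, _, isCoding_pureInterpretation p, purePart_models hM hR,
      (Fin.elim0, fun _ => W), _, _, (Fin.elim0, fun _ => H), admissible_urInterpretation _, hJ, ?_⟩
    refine definesIso_plainIso (fun Y => ?_) H hH
    refine (hf.classes_symm Y).trans (iff_of_eq ?_)
    exact congrArg (· ∈ ClassModel.classes _) (Set.image_comp Subtype.val f.symm Y).symm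

theorem mainTheorem6 :
    BiInterpretable.{u} (fun M => M.IsKM ∧ M.RP2)
      (fun M => M.IsKMU ∧ M.RP2 ∧ M.LimitationOfSize) ∧
    (∀ M : ClassModel.{u}, M.IsKM → M.RP2 → ∀ W ∈ M.classes,
      (∃! D, M.IsUrDomain W D) ∧
      ∀ D, M.IsUrDomain W D →
        (M.urExtension W D).IsKMU ∧ (M.urExtension W D).RP2 ∧
        (M.urExtension W D).LimitationOfSize) ∧
    (∀ M : ClassModel.{u}, M.IsKMU → M.RP2 → M.purePart.IsKM ∧ M.purePart.RP2) :=
  ⟨biInterpretable_km_kmu, fun _ hM hR W hW =>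
    ⟨(hM.kmu.core hR).existsUnique_isUrDomain ⟨W, hW⟩, fun D hD =>
      ClassModel.urExtension_models hM hR (W := ⟨W, hW⟩) (D := ⟨D, hD.1⟩) hD⟩,
    fun _ hM hR => ClassModel.purePart_models hM hR⟩
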